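/- Let $(\Omega,\Sigma,\mu)$ be a probability space, $N\ge 0$, and $P=\mu^N$ on $\Omega^N$. Let $h:\Omega\times\Omega\to[0,\infty)$ satisfy $h(\omega,\omega)=0$ for all $\omega$, and write $h(x,B)=\inf_{y\in B}h(x,y)$. Let $\psi:\mathbb R\to\mathbb R$ be convex with $\psi(0)=0$, $\psi(x)\le x^2$ for $x\le 1$ and $\psi(x)\ge x$ for $x\ge 1$. For $A\subset\Omega^N$ and $x\in\Omega^N$ let $$U_A(x)=\{s\in\mathbb R_+^N:\ \exists y\in A\ \forall i\le N,\ s_i\ge h(x_i,y_i)\},$$ let $V_A(x)$ be the convex hull of $U_A(x)$, and let $$f_{h,\psi}(A,x)=\inf\Big\{\sum_{i\le N}\psi(s_i):\ s\in V_A(x)\Big\}.$$ All functions to be integrated are understood to be measurable: for every $n$ and every measurable $A\subset\Omega^n$ the function $f_{h,\psi}(A,\cdot)$ is measurable for the completion of $\mu^n$. Let $\theta:(0,1]\to[0,\infty)$ be convex and decreasing with $\theta(1)=0$ and $\lim_{x\to0}\theta(x)=\infty$, and let $\xi:[0,\infty)\to(0,1]$ be its inverse function. Assume that $\xi$ is differentiable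 on $[0,\infty)$ and twice differentiable on $(0,\infty)$, that $\xi''$ is nonincreasing on $(0,\infty)$, and that $\xi''(b)\le|\xi'(b)|$ for $b>0$. (Derivatives at end points are one-sided.) Let $w:(0,1]\to[0,\infty)$ be nonincreasing with $w\le\theta$ and $\int_0^1w^2\,d\lambda\le1$, where $\lambda$ is Lebesgue measure. Let $\gamma>0$ be such that $$|\xi'(b+1)|\ge\gamma|\xi'(b)|\quad(b\ge0),\qquad |\theta'(1)|\ge\gamma,\qquad w(1/2)\ge\gamma.$$ With $\Xi(x,b)=\xi(x^+)-\xi(b)-(x^+-b)\xi'(b)$, assume condition $H(\xi,w)$: $$\forall b\ge0,\ \forall t\in[0,1],\qquad \int_0^1\Xi(b-tw(u),b)\,d\lambda(u)\le t^2|\xi'(b)|.$$ Assume finally that for each measurable $B\subset\Omega$ $$0<\mu(B)\le\tfrac12\ \Longrightarrow\ \int_\Omega\exp\psi(h(x,B))\,d\mu(x)\le\exp w(\mu(B)),$$ $$\mu(B)\ge\tfrac12,\ t\ge1\ \Longrightarrow\ \mu(\{x:\psi(h(x,B))\ge t\})\le e^{-t}(1-\mu(B)).$$ Then, for each measurable $A\subset\Omega^N$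 with $P(A)>0$, $$\int_{\Omega^N}\exp\Big(\frac1K f_{h,\psi}(A,x)\Big)\,dP(x)\le\exp\theta(P(A)),$$ where $K>0$ depends on $\gamma$ only. -/

import Mathlib

open Set Filter Topology MeasureTheory

noncomputable section

/-- The derivative of a function on `[0, ∞)`; at `0` it is the right derivative. -/
def derivOnNonneg (ξ : ℝ → ℝ) (b : ℝ) : ℝ := derivWithin ξ (Ici 0) b

/-- The standing assumptions on `θ : (0, 1] → [0, ∞)` and its inverse `ξ : [0, ∞) → (0, 1]`.
Values of `θ` off `(0, 1]` and of `ξ` off `[0, ∞)` play no role. -/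
structure ThetaXi (θ ξ : ℝ → ℝ) : Prop where
  convex : ConvexOn ℝ (Ioc 0 1) θ
  decreasing : StrictAntiOn θ (Ioc 0 1)
  map_one : θ 1 = 0
  tendsto_zero : Tendsto θ (𝓝[>] 0) atTop
  theta_maps : MapsTo θ (Ioc 0 1) (Ici 0)
  xi_maps : MapsTo ξ (Ici 0) (Ioc 0 1)
  inverse : InvOn ξ θ (Ioc 0 1) (Ici 0)
  xi_diff : DifferentiableOn ℝ ξ (Ici 0)
  xi_diff_two : DifferentiableOn ℝ (deriv ξ) (Ioi 0)
  xi_second_anti : AntitoneOn (deriv (deriv ξ)) (Ioi 0)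
  xi_second_le : ∀ b, 0 < b → deriv (deriv ξ) b ≤ |deriv ξ b|

/-- `Ξ(x, b) = ξ(x⁺) - ξ(b) - (x⁺ - b) ξ'(b)`. -/
def bigXi (ξ : ℝ → ℝ) (x b : ℝ) : ℝ :=
  ξ (max x 0) - ξ b - (max x 0 - b) * derivOnNonneg ξ b

/-- Condition `H(ξ, w)`. For `w ≥ 0` nonincreasing on `(0, 1]` the integrand is bounded and
measurable, so that the integral is a genuine one. -/
def ConditionH (ξ w : ℝ → ℝ) : Prop :=
  ∀ b : ℝ, 0 ≤ b → ∀ t : ℝ, 0 ≤ t → t ≤ 1 →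
    ∫ u in (0 : ℝ)..1, bigXi ξ (b - t * w u) b ≤ t ^ 2 * |derivOnNonneg ξ b|

/-- `h(x, B) = inf {h(x, y) ; y ∈ B}` (used for nonempty `B` and `h ≥ 0`). -/
def penaltyToSet {Ω : Type*} (h : Ω → Ω → ℝ) (x : Ω) (B : Set Ω) : ℝ :=
  sInf ((fun y => h x y) '' B)

/-- `U_A(x)`: the vectors of `ℝ₊^N` that dominate `(h(x_i, y_i))_i` for some `y ∈ A`. -/
def penaltySet {Ω : Type*} {N : ℕ} (h : Ω → Ω → ℝ) (A : Set (Fin N → Ω)) (x : Fin N → Ω) :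
    Set (Fin N → ℝ) :=
  {s | (∀ i, 0 ≤ s i) ∧ ∃ y ∈ A, ∀ i, h (x i) (y i) ≤ s i}

/-- `V_A(x)`: the convex hull of `U_A(x)`. -/
def penaltyHull {Ω : Type*} {N : ℕ} (h : Ω → Ω → ℝ) (A : Set (Fin N → Ω)) (x : Fin N → Ω) :
    Set (Fin N → ℝ) :=
  convexHull ℝ (penaltySet h A x)

/-- `f_{h,ψ}(A, x) = inf {∑ i, ψ (s i) ; s ∈ V_A(x)}` (used for nonempty `A`). -/
def penaltyDist {Ω : Type*} {N : ℕ} (h : Ω → Ω → ℝ) (ψ : ℝ → ℝ) (A : Set (Fin N → Ω))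
    (x : Fin N → Ω) : ℝ :=
  sInf ((fun s : Fin N → ℝ => ∑ i, ψ (s i)) '' penaltyHull h A x)

/-- The convention that the functions whose integrals are considered are measurable (for the
completed product measures): `f_{h,ψ}(A, ·)` is measurable for every measurable `A`. Its
one-dimensional case is the measurability of `x ↦ ψ (h(x, B))`. If `Ω` is a standard Borel space
and `h` is a Borel function this always holds, since the sets `{f_{h,ψ}(A, ·) < t}` are analytic. -/
def PenaltyMeasurable {Ω : Type*} [MeasurableSpace Ω] (μ : Measure Ω) (h : Ω → Ω → ℝ)
    (ψ : ℝ → ℝ) : Prop :=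
  ∀ (n : ℕ) (A : Set (Fin n → Ω)), MeasurableSet A →
    AEMeasurable (fun x => penaltyDist h ψ A x) (Measure.pi fun _ : Fin n => μ)

end

/-!
The theorem is proved by induction on the dimension, with `K = 10 ^ 6 (1 + 2 / γ) ^ 2`.

Let `A(ω)` be the section of `A ⊆ Ω ^ (N + 1)` at the first coordinate `ω`, let
`g ω = θ (P (A(ω)))`, and let `G ω` be the integral of `exp (f / K)` over the other coordinates.
Because `f` is defined through a convex hull, the sections at `ω` and `ω'` can be mixed with weights
`1 - s` and `s` at the price `ψ (s h(ω, ω'))` only (`penaltyDist_cons_le`). Hölder's inequality and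
the induction hypothesis then give
`log (G ω) ≤ ψ (s h(ω, ω')) / K + (1 - s) g ω + s g ω'`, and since `P A = ∫ ξ(g)`, it remains to
prove `∫ ξ(g) ≤ ξ(M)` with `M = log ∫ G`: this is the one-dimensional inequality
`Transport.integral_xi_le`.

As `ξ` is convex, it suffices to prove the linearization of that inequality at a single point `b`.
There are two cases.

* If the median of `g` exceeds `M + 4 / K`, take `b = M + 4 / K`. The hypothesis on the sets of
  measure at most `1 / 2` forces `M ≤ a + w (μ {g ≤ a}) / K` for the levels `a < b`, so that `g`
  lies below `b` by at most `4 / K + w (U) / K`, where `U` is stochastically larger than a uniform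
  variable (`lintegral_levelMass_le`). Since `∫ w ≤ 1` the mean depth is at most `3 / K`, and
  condition `H(ξ, w)` bounds the second-order term by a multiple of `1 / K ^ 2`.

* Otherwise take for `b` the median. Let `t` be the least number with `b - g ≤ t w (U)`; it is at
  most of order `1 / K`. By `H(ξ, w)` and `∫ w ^ 2 ≤ 1` the losses below `b` are of order `t ^ 2`. On the
  other hand, if `t > 0` there is a level `a < b`, of measure `u`, with `b - a ≥ t w(u) / 2`; by Markov's
  inequality a quarter of the space lies above `b` and at penalty at most `w(u) + 2` from this
  level. For such points interpolation with `s` of order `t / w(u)` gains a large multiple of `t ^ 2`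
  in the exponent (`Transport.le_of_below`), because the quadratic cost is divided by `K`.

  Above `b` the losses are quadratic in the height `δ = g - b`. This uses
  `ξ(b) - ξ(y) ≥ |ξ'(b)| (1 - e ^ {-(y - b)})`, a consequence of `ξ'' ≤ |ξ'|`. Interpolation with a
  level between `b + δ / 4` and `b + δ / 2` more than compensates them, except at points at penalty
  at least `20` from that level. By the hypothesis on the sets of measure at least `1 / 2` these are
  a small proportion of the points above the level, so a sum over dyadic levels
  (`lintegral_farError_le`) shows that they contribute little.
-/

/-! ### The function `ξ` -/

namespace ThetaXi

variable {θ ξ : ℝ → ℝ} {b x y : ℝ}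

lemma theta_xi (H : ThetaXi θ ξ) (hb : 0 ≤ b) : θ (ξ b) = b := H.inverse.2 hb

lemma xi_theta (H : ThetaXi θ ξ) (hx : x ∈ Ioc (0 : ℝ) 1) : ξ (θ x) = x := H.inverse.1 hx

lemma xi_strictAnti (H : ThetaXi θ ξ) : StrictAntiOn ξ (Ici 0) := by
  intro x hx y hy hxy
  by_contra! hle
  have := H.decreasing.antitoneOn (H.xi_maps hx) (H.xi_maps hy) hle
  rw [H.theta_xi hx, H.theta_xi hy] at this
  exact absurd hxy (not_lt.2 this)

lemma xi_convex (H : ThetaXi θ ξ) : ConvexOn ℝ (Ici 0) ξ := by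
  refine ⟨convex_Ici 0, fun x hx y hy s t hs ht hst => ?_⟩
  have hmem := (convex_Ioc (0 : ℝ) 1) (H.xi_maps hx) (H.xi_maps hy) hs ht hst
  have h1 := H.convex.2 (H.xi_maps hx) (H.xi_maps hy) hs ht hst
  rw [H.theta_xi hx, H.theta_xi hy] at h1
  have h2 := H.xi_strictAnti.antitoneOn (H.theta_maps hmem)
    ((convex_Ici (0 : ℝ)) hx hy hs ht hst) h1
  rwa [H.xi_theta hmem] at h2

lemma hasDerivWithinAt (H : ThetaXi θ ξ) (hb : 0 ≤ b) :
    HasDerivWithinAt ξ (derivOnNonneg ξ b) (Ici 0) b :=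
  (H.xi_diff b hb).hasDerivWithinAt

lemma hasDerivAt (H : ThetaXi θ ξ) (hb : 0 < b) : HasDerivAt ξ (deriv ξ b) b :=
  ((H.xi_diff b hb.le).differentiableAt (Ici_mem_nhds hb)).hasDerivAt

lemma derivOnNonneg_eq (hb : 0 < b) : derivOnNonneg ξ b = deriv ξ b :=
  derivWithin_of_mem_nhds (Ici_mem_nhds hb)

/-- A convex function lies above its tangents. -/
lemma tangent_le (H : ThetaXi θ ξ) (hb : 0 ≤ b) (hy : 0 ≤ y) :
    ξ b + (y - b) * derivOnNonneg ξ b ≤ ξ y := by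
  rcases lt_trichotomy b y with h | h | h
  · have := H.xi_convex.le_slope_of_hasDerivWithinAt hb hy h (H.hasDerivWithinAt hb)
    rw [slope_def_field, le_div_iff₀ (by linarith)] at this
    linarith
  · simp [h]
  · have := H.xi_convex.slope_le_of_hasDerivWithinAt hy hb h (H.hasDerivWithinAt hb)
    rw [slope_def_field, div_le_iff₀ (by linarith)] at this
    linarith

lemma deriv_neg (H : ThetaXi θ ξ) (hb : 0 ≤ b) : derivOnNonneg ξ b < 0 := by
  have h1 := H.tangent_le hb (show (0 : ℝ) ≤ b + 1 by linarith)
  have h2 := H.xi_strictAnti hb (show (0 : ℝ) ≤ b + 1 by linarith) (by linarith : b < b + 1)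
  linarith

lemma abs_deriv (H : ThetaXi θ ξ) (hb : 0 ≤ b) : |derivOnNonneg ξ b| = -derivOnNonneg ξ b :=
  abs_of_neg (H.deriv_neg hb)

/-- The differential inequality `ξ'' ≤ |ξ'|` says that `e ^ y ξ'(y)` is nonincreasing. -/
lemma exp_mul_deriv_anti (H : ThetaXi θ ξ) :
    AntitoneOn (fun y => Real.exp y * deriv ξ y) (Ioi 0) := by
  have hd : ∀ y ∈ Ioi (0 : ℝ), HasDerivAt (fun y => Real.exp y * deriv ξ y)
      (Real.exp y * deriv ξ y + Real.exp y * deriv (deriv ξ) y) y := fun y hy =>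
    (Real.hasDerivAt_exp y).mul
      ((H.xi_diff_two y hy).differentiableAt (Ioi_mem_nhds hy)).hasDerivAt
  refine antitoneOn_of_deriv_nonpos (convex_Ioi 0)
    (fun y hy => (hd y hy).continuousAt.continuousWithinAt) ?_ ?_
  · rw [interior_Ioi]
    exact fun y hy => (hd y hy).differentiableAt.differentiableWithinAt
  · rw [interior_Ioi]
    intro y hy
    rw [(hd y hy).deriv, ← mul_add]
    have h1 := H.xi_second_le y hy
    have h2 := H.deriv_neg (le_of_lt hy)
    rw [derivOnNonneg_eq hy] at h2
    rw [abs_of_neg h2] at h1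
    exact mul_nonpos_of_nonneg_of_nonpos (Real.exp_pos y).le (by linarith)

lemma deriv_le_of_pos (H : ThetaXi θ ξ) (hb : 0 ≤ b) (hy : b < y) :
    deriv ξ y ≤ Real.exp (b - y) * derivOnNonneg ξ b := by
  rcases hb.eq_or_lt with rfl | hb'
  · -- At the end point `0` the derivative is a limit of the slopes `(ξ c - ξ 0) / c`.
    have hlim := (hasDerivWithinAt_iff_tendsto_slope' (by simp)).1
      ((H.hasDerivWithinAt le_rfl).mono Ioi_subset_Ici_self)
    have hlim2 := hlim.const_mul (Real.exp (0 - y))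
    refine ge_of_tendsto hlim2 ?_
    filter_upwards [Ioo_mem_nhdsGT hy] with c hc
    obtain ⟨z, hz, hzs⟩ := exists_deriv_eq_slope ξ hc.1
      (H.xi_diff.continuousOn.mono Icc_subset_Ici_self)
      (fun z hz => (H.hasDerivAt hz.1).differentiableAt.differentiableWithinAt)
    have hzy : z < y := hz.2.trans hc.2
    have h2 := H.exp_mul_deriv_anti hz.1 hy hzy.le
    simp only at h2
    have h3 : deriv ξ y ≤ Real.exp (z - y) * deriv ξ z := by
      rw [Real.exp_sub, div_mul_eq_mul_div, le_div_iff₀ (Real.exp_pos y)]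
      linarith
    have h4 := H.deriv_neg hz.1.le
    rw [derivOnNonneg_eq hz.1] at h4
    have h5 : Real.exp (0 - y) ≤ Real.exp (z - y) := Real.exp_le_exp.2 (by linarith [hz.1])
    rw [slope_def_field, ← hzs]
    exact h3.trans (mul_le_mul_of_nonpos_right h5 h4.le)
  · rw [derivOnNonneg_eq hb', Real.exp_sub, div_mul_eq_mul_div, le_div_iff₀ (Real.exp_pos y)]
    have := H.exp_mul_deriv_anti hb' (hb'.trans hy) hy.le
    simp only at this
    linarith

/-- For `y ≥ b` the decrease of `ξ` is at least that of `|ξ'(b)| e ^ {-(y - b)}`. -/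
lemma one_sub_exp_le (H : ThetaXi θ ξ) (hb : 0 ≤ b) (hy : b ≤ y) :
    |derivOnNonneg ξ b| * (1 - Real.exp (b - y)) ≤ ξ b - ξ y := by
  rw [H.abs_deriv hb]
  have hd : ∀ z ∈ Ioi b, HasDerivAt (fun z => ξ z + derivOnNonneg ξ b * Real.exp (b - z))
      (deriv ξ z + derivOnNonneg ξ b * (Real.exp (b - z) * (-1))) z := fun z hz =>
    (H.hasDerivAt (lt_of_le_of_lt hb hz)).add
      ((((hasDerivAt_id z).const_sub b).exp).const_mul _)
  have : AntitoneOn (fun z => ξ z + derivOnNonneg ξ b * Real.exp (b - z)) (Ici b) := by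
    refine antitoneOn_of_deriv_nonpos (convex_Ici b) ?_ ?_ ?_
    · refine ContinuousOn.add (H.xi_diff.continuousOn.mono (Ici_subset_Ici.2 hb)) ?_
      fun_prop
    · rw [interior_Ici]
      exact fun z hz => (hd z hz).differentiableAt.differentiableWithinAt
    · rw [interior_Ici]
      intro z hz
      rw [(hd z hz).deriv]
      have := H.deriv_le_of_pos hb hz
      linarith
  have h := this self_mem_Ici hy hy
  simp only [sub_self, Real.exp_zero] at h
  linarith

lemma bigXi_of_nonneg (hx : 0 ≤ x) :
    bigXi ξ x b = ξ x - ξ b - (x - b) * derivOnNonneg ξ b := by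
  rw [bigXi, max_eq_left hx]

lemma bigXi_nonneg (H : ThetaXi θ ξ) (hb : 0 ≤ b) (x : ℝ) : 0 ≤ bigXi ξ x b := by
  have := H.tangent_le hb (le_max_right x 0)
  rw [bigXi]; linarith

lemma bigXi_anti (H : ThetaXi θ ξ) (hb : 0 ≤ b) (hxy : x ≤ y) (hy : y ≤ b) :
    bigXi ξ y b ≤ bigXi ξ x b := by
  have hx0 := le_max_right x 0
  have hy0 := le_max_right y 0
  have hm : max x 0 ≤ max y 0 := max_le_max_right 0 hxy
  have hyb : max y 0 ≤ b := max_le hy hb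
  have h1 := H.tangent_le hy0 hx0
  have h2 := H.xi_convex.monotoneOn_derivWithin H.xi_diff hy0 hb hyb
  rw [bigXi, bigXi]
  have : (max x 0 - max y 0) * derivOnNonneg ξ b ≤ (max x 0 - max y 0) * derivOnNonneg ξ (max y 0) :=
    mul_le_mul_of_nonpos_left h2 (by linarith)
  linarith

lemma bigXi_le (H : ThetaXi θ ξ) (hb : 0 ≤ b) (hx : x ≤ b) : bigXi ξ x b ≤ bigXi ξ 0 b := by
  rcases le_total x 0 with h | h
  · rw [bigXi, bigXi, max_eq_right h, max_self]
  · exact H.bigXi_anti hb h hx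

end ThetaXi

/-! ### Comparison with the uniform distribution -/

/-- If a measure on `(0, 1]` gives each initial interval at most its length, then antitone functions
have a smaller integral against it than against Lebesgue measure. -/
lemma lintegral_antitoneOn_le {ν : Measure ℝ} (h0 : ∀ v, ν (Iic v) ≤ ENNReal.ofReal v)
    (h1 : ν (Ioi 1) = 0) {F : ℝ → ℝ} (hF : AntitoneOn F (Ioc 0 1))
    (hF0 : ∀ u ∈ Ioc (0 : ℝ) 1, 0 ≤ F u) :
    ∫⁻ u, ENNReal.ofReal (F u) ∂ν ≤ ∫⁻ u in Ioc (0 : ℝ) 1, ENNReal.ofReal (F u) := by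
  have hae : ∀ᵐ u ∂ν, u ∈ Ioc (0 : ℝ) 1 := by
    have h2 : ν (Iic 0) = 0 := by simpa using h0 0
    have : ν (Ioc (0 : ℝ) 1)ᶜ = 0 := by
      refine measure_mono_null ?_ (measure_union_null h2 h1)
      intro u hu
      by_contra hc
      simp only [mem_union, mem_Iic, mem_Ioi, not_or, not_le, not_lt] at hc
      exact hu hc
    exact this
  have hres : ν.restrict (Ioc (0 : ℝ) 1) = ν := Measure.restrict_eq_self_of_ae_mem hae
  have hm : AEMeasurable F ν := by
    rw [← hres]; exact aemeasurable_restrict_of_antitoneOn measurableSet_Ioc hF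
  rw [lintegral_eq_lintegral_meas_lt ν (hae.mono fun u hu => hF0 u hu) hm,
    lintegral_eq_lintegral_meas_lt (volume.restrict (Ioc (0 : ℝ) 1))
      ((ae_restrict_iff' measurableSet_Ioc).2 (Eventually.of_forall hF0))
      (aemeasurable_restrict_of_antitoneOn measurableSet_Ioc hF)]
  refine lintegral_mono fun s => ?_
  have hν : ν {u | s < F u} ≤ ν ({u | s < F u} ∩ Ioc 0 1) := by
    refine measure_mono_ae ?_
    filter_upwards [hae] with u hu h using ⟨h, hu⟩
  have hvol : volume ({u | s < F u} ∩ Ioc 0 1) ≤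
      volume.restrict (Ioc (0 : ℝ) 1) {u | s < F u} := Measure.le_restrict_apply _ _
  refine (hν.trans ?_).trans hvol
  set J := {u | s < F u} ∩ Ioc 0 1 with hJ
  rcases J.eq_empty_or_nonempty with hJe | hJe
  · simp [hJe]
  have hbdd : BddAbove J := ⟨1, fun u hu => hu.2.2⟩
  have hup : J ⊆ Iic (sSup J) := fun u hu => le_csSup hbdd hu
  have hdown : Ioo 0 (sSup J) ⊆ J := by
    intro u hu
    obtain ⟨z, hz, huz⟩ := exists_lt_of_lt_csSup hJe hu.2
    have hu1 : u ∈ Ioc (0 : ℝ) 1 := ⟨hu.1, huz.le.trans hz.2.2⟩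
    exact ⟨hz.1.trans_le (hF hu1 hz.2 huz.le), hu1⟩
  calc ν J ≤ ν (Iic (sSup J)) := measure_mono hup
    _ ≤ ENNReal.ofReal (sSup J) := h0 _
    _ = volume (Ioo 0 (sSup J)) := by rw [Real.volume_Ioo, sub_zero]
    _ ≤ volume J := measure_mono hdown

section

variable {Ω : Type*} [MeasurableSpace Ω] {μ : Measure Ω} [IsProbabilityMeasure μ] {g : Ω → ℝ}

lemma levelMass_mono (μ : Measure Ω) [IsProbabilityMeasure μ] (g : Ω → ℝ) :
    Monotone fun x : ℝ => μ.real {ω | g ω ≤ x} := fun _ _ hxy =>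
  measureReal_mono fun _ hω => le_trans hω hxy

/-- The distribution function of `g`, evaluated at `g`, is stochastically at least uniform. -/
lemma measure_levelMass_le (v : ℝ) :
    μ {ω | μ.real {ω' | g ω' ≤ g ω} ≤ v} ≤ ENNReal.ofReal v := by
  have key : ∀ x, μ.real {ω' | g ω' ≤ x} ≤ v → μ {ω' | g ω' ≤ x} ≤ ENNReal.ofReal v := by
    intro x hx
    rw [← ofReal_measureReal]
    exact ENNReal.ofReal_le_ofReal hx
  have seq : ∀ z : ℕ → ℝ, Monotone z → (∀ n, μ.real {ω' | g ω' ≤ z n} ≤ v) →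
      {ω | μ.real {ω' | g ω' ≤ g ω} ≤ v} ⊆ ⋃ n, {ω | g ω ≤ z n} →
      μ {ω | μ.real {ω' | g ω' ≤ g ω} ≤ v} ≤ ENNReal.ofReal v := by
    intro z hz hzv hsub
    refine (measure_mono hsub).trans ?_
    have hmono : Monotone fun n => {ω | g ω ≤ z n} := fun i j hij ω hω => le_trans hω (hz hij)
    rw [hmono.measure_iUnion]
    exact iSup_le fun n => key _ (hzv n)
  set S : Set ℝ := {x | μ.real {ω' | g ω' ≤ x} ≤ v} with hS
  rcases S.eq_empty_or_nonempty with hSe | hSe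
  · have : {ω | μ.real {ω' | g ω' ≤ g ω} ≤ v} = ∅ := by
      ext ω
      simp only [mem_ofPred_eq, mem_empty_iff_false, iff_false]
      intro h
      have : g ω ∈ S := h
      simp [hSe] at this
    simp [this]
  by_cases hb : BddAbove S
  · by_cases hs : sSup S ∈ S
    · exact seq (fun _ => sSup S) monotone_const (fun _ => hs)
        fun ω hω => mem_iUnion.2 ⟨0, le_csSup hb hω⟩
    · obtain ⟨z, hz, hzs, hzt⟩ := exists_seq_strictMono_tendsto (sSup S)
      refine seq z hz.monotone (fun n => ?_) fun ω hω => ?_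
      · obtain ⟨y, hy, hyn⟩ := exists_lt_of_lt_csSup hSe (hzs n)
        exact (levelMass_mono μ g hyn.le).trans hy
      · have hlt : g ω < sSup S :=
          lt_of_le_of_ne (le_csSup hb hω) fun h => hs (h ▸ hω)
        obtain ⟨n, hn⟩ := (hzt.eventually (lt_mem_nhds hlt)).exists
        exact mem_iUnion.2 ⟨n, hn.le⟩
  · refine seq (fun n => n) Nat.mono_cast (fun n => ?_) fun ω _ => ?_
    · obtain ⟨y, hy, hyn⟩ := not_bddAbove_iff.1 hb n
      exact (levelMass_mono μ g hyn.le).trans hy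
    · exact mem_iUnion.2 (exists_nat_ge (g ω))

/-- The quantile comparison: `F` of the mass of the level of `g` integrates to at most `∫ F`. -/
lemma lintegral_levelMass_le (hg : Measurable g) {F : ℝ → ℝ} (hF : AntitoneOn F (Ioc 0 1))
    (hF0 : ∀ u ∈ Ioc (0 : ℝ) 1, 0 ≤ F u) :
    ∫⁻ ω, ENNReal.ofReal (F (μ.real {ω' | g ω' ≤ g ω})) ∂μ
      ≤ ∫⁻ u in Ioc (0 : ℝ) 1, ENNReal.ofReal (F u) := by
  have hU : Measurable fun ω => μ.real {ω' | g ω' ≤ g ω} :=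
    (levelMass_mono μ g).measurable.comp hg
  have h0 : ∀ v, (μ.map fun ω => μ.real {ω' | g ω' ≤ g ω}) (Iic v) ≤ ENNReal.ofReal v := by
    intro v
    rw [Measure.map_apply hU measurableSet_Iic]
    exact measure_levelMass_le v
  have h1 : (μ.map fun ω => μ.real {ω' | g ω' ≤ g ω}) (Ioi 1) = 0 := by
    rw [Measure.map_apply hU measurableSet_Ioi]
    convert measure_empty (μ := μ)
    ext ω
    simp [measureReal_le_one]
  refine le_trans (le_of_eq ?_) (lintegral_antitoneOn_le h0 h1 hF hF0)
  rw [lintegral_map' (f := fun u => ENNReal.ofReal (F u)) ?_ hU.aemeasurable]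
  have hae : (μ.map fun ω => μ.real {ω' | g ω' ≤ g ω}).restrict (Ioc (0 : ℝ) 1)
      = μ.map fun ω => μ.real {ω' | g ω' ≤ g ω} := by
    refine Measure.restrict_eq_self_of_ae_mem ?_
    have h2 := h0 0
    rw [ENNReal.ofReal_zero, nonpos_iff_eq_zero] at h2
    refine measure_mono_null ?_ (measure_union_null h2 h1)
    intro u hu
    by_contra hc
    simp only [mem_union, mem_Iic, mem_Ioi, not_or, not_le, not_lt] at hc
    exact hu hc
  rw [← hae]
  exact (aemeasurable_restrict_of_antitoneOn measurableSet_Ioc hF).ennreal_ofReal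

lemma ae_levelMass_pos : ∀ᵐ ω ∂μ, 0 < μ.real {ω' | g ω' ≤ g ω} := by
  have := measure_levelMass_le (μ := μ) (g := g) 0
  rw [ENNReal.ofReal_zero, nonpos_iff_eq_zero] at this
  simpa [ae_iff] using this

end

/-! ### Penalties -/

/-- The standing assumptions on the penalty function `h` and on the convex function `ψ`. -/
structure Penalty {Ω : Type*} (h : Ω → Ω → ℝ) (ψ : ℝ → ℝ) : Prop where
  nonneg : ∀ x y, 0 ≤ h x y
  self : ∀ x, h x x = 0
  convex : ConvexOn ℝ univ ψ
  zero : ψ 0 = 0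
  le_sq : ∀ x, x ≤ 1 → ψ x ≤ x ^ 2
  ge_id : ∀ x, 1 ≤ x → x ≤ ψ x

namespace Penalty

variable {Ω : Type*} {h : Ω → Ω → ℝ} {ψ : ℝ → ℝ}

/-- `ψ` lies below a parabola with vertex at its zero `0`, so by convexity it has a minimum there. -/
lemma psi_nonneg (H : Penalty h ψ) (x : ℝ) : 0 ≤ ψ x := by
  by_contra! hx
  -- Convexity between `x` and `-s x` gives `0 ≤ ψ x + s x ^ 2` for all small `s > 0`.
  have key : ∀ s : ℝ, 0 < s → s * |x| ≤ 1 → 0 ≤ ψ x + s * x ^ 2 := by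
    intro s hs hsx
    have h1 := H.convex.2 (mem_univ x) (mem_univ (-(s * x)))
      (show 0 ≤ s / (1 + s) by positivity) (show 0 ≤ 1 / (1 + s) by positivity)
      (by field_simp; ring)
    have h2 : (s / (1 + s)) • x + (1 / (1 + s)) • (-(s * x)) = 0 := by
      simp only [smul_eq_mul]; field_simp; ring
    rw [h2, H.zero] at h1
    have h3 : ψ (-(s * x)) ≤ (-(s * x)) ^ 2 := H.le_sq _ (by
      rw [← abs_of_pos hs, ← abs_mul] at hsx
      linarith [neg_abs_le (s * x)])
    simp only [smul_eq_mul] at h1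
    have h4 : 0 ≤ s * ψ x + ψ (-(s * x)) := by
      have h5 : s / (1 + s) * ψ x + 1 / (1 + s) * ψ (-(s * x))
        = (s * ψ x + ψ (-(s * x))) / (1 + s) := by field_simp
      rw [h5] at h1
      have := mul_nonneg h1 (by positivity : (0 : ℝ) ≤ 1 + s)
      rwa [div_mul_cancel₀ _ (by positivity)] at this
    have h6 : 0 ≤ s * (ψ x + s * x ^ 2) := by nlinarith
    exact nonneg_of_mul_nonneg_right h6 hs
  have hx2 : 0 < x ^ 2 := by
    rcases eq_or_ne x 0 with rfl | hne
    · rw [H.zero] at hx; exact absurd hx (lt_irrefl _)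
    · positivity
  have hax : 0 < |x| := by
    rw [abs_pos]; rintro rfl; norm_num at hx2
  set s := min (1 / |x|) (-ψ x / (2 * x ^ 2)) with hs
  have hs0 : 0 < s := lt_min (by positivity) (div_pos (by linarith) (by positivity))
  have hs1 : s * |x| ≤ 1 := by
    calc s * |x| ≤ 1 / |x| * |x| := mul_le_mul_of_nonneg_right (min_le_left _ _) hax.le
      _ = 1 := by field_simp
  have hs2 : s * x ^ 2 ≤ -ψ x / 2 := by
    calc s * x ^ 2 ≤ -ψ x / (2 * x ^ 2) * x ^ 2 :=
          mul_le_mul_of_nonneg_right (min_le_right _ _) hx2.le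
      _ = -ψ x / 2 := by
          have := hx2.ne'
          rw [div_mul_eq_mul_div, div_eq_div_iff (by positivity) two_ne_zero]; ring
  linarith [key s hs0 hs1]

lemma psi_mono (H : Penalty h ψ) : MonotoneOn ψ (Ici 0) := by
  intro x hx y hy hxy
  rcases (show (0 : ℝ) ≤ x from hx).eq_or_lt with h0 | h0
  · rw [← h0, H.zero]; exact H.psi_nonneg y
  have hy0 : 0 < y := h0.trans_le hxy
  have h1 := H.convex.2 (mem_univ y) (mem_univ 0) (show 0 ≤ x / y by positivity)
    (show 0 ≤ 1 - x / y by rw [sub_nonneg, div_le_one hy0]; exact hxy) (by ring)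
  simp only [smul_eq_mul, mul_zero, add_zero, H.zero] at h1
  rw [div_mul_cancel₀ _ hy0.ne'] at h1
  refine h1.trans (mul_le_of_le_one_left (H.psi_nonneg y) ?_)
  rw [div_le_one hy0]; exact hxy

lemma psi_continuous (H : Penalty h ψ) : Continuous ψ := by
  rw [← continuousOn_univ]
  exact H.convex.continuousOn isOpen_univ

lemma lt_of_psi_lt (H : Penalty h ψ) {x T : ℝ} (hT : 1 ≤ T) (hx : ψ x < T) : x < T := by
  rcases le_total 1 x with h1 | h1
  · exact (H.ge_id x h1).trans_lt hx
  · rcases h1.eq_or_lt with rfl | h1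
    · exact (H.ge_id 1 le_rfl).trans_lt hx
    · linarith

lemma psi_mul_le (H : Penalty h ψ) {s x T : ℝ} (hs : 0 ≤ s) (hx0 : 0 ≤ x) (hx : x ≤ T)
    (hsT : s * T ≤ 1) : ψ (s * x) ≤ s ^ 2 * T ^ 2 := by
  have h1 : s * x ≤ s * T := mul_le_mul_of_nonneg_left hx hs
  refine (H.le_sq _ (h1.trans hsT)).trans ?_
  rw [← mul_pow]
  exact pow_le_pow_left₀ (mul_nonneg hs hx0) h1 2

lemma bddBelow (H : Penalty h ψ) (x : Ω) (B : Set Ω) : BddBelow ((fun y => h x y) '' B) :=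
  ⟨0, by rintro _ ⟨y, -, rfl⟩; exact H.nonneg x y⟩

lemma toSet_nonneg (H : Penalty h ψ) (x : Ω) (B : Set Ω) : 0 ≤ penaltyToSet h x B :=
  Real.sInf_nonneg (by rintro _ ⟨y, -, rfl⟩; exact H.nonneg x y)

lemma toSet_le (H : Penalty h ψ) (x : Ω) {B : Set Ω} {y : Ω} (hy : y ∈ B) :
    penaltyToSet h x B ≤ h x y :=
  csInf_le (H.bddBelow x B) (mem_image_of_mem _ hy)

/-- As `ψ` is continuous, a bound on `ψ (h(x, B))` is nearly attained. -/
lemma exists_psi_lt (H : Penalty h ψ) {x : Ω} {B : Set Ω} (hB : B.Nonempty) {T : ℝ}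
    (hT : ψ (penaltyToSet h x B) < T) : ∃ y ∈ B, ψ (h x y) < T := by
  have h1 : ∀ᶠ z in 𝓝 (penaltyToSet h x B), ψ z < T :=
    H.psi_continuous.continuousAt.eventually (gt_mem_nhds hT)
  obtain ⟨ε, hε, hball⟩ := Metric.eventually_nhds_iff.1 h1
  obtain ⟨_, ⟨y, hy, rfl⟩, hlt⟩ := exists_lt_of_csInf_lt (hB.image fun y => h x y)
    (show penaltyToSet h x B < penaltyToSet h x B + ε by linarith)
  refine ⟨y, hy, hball ?_⟩
  have := H.toSet_le x hy
  simp only at hlt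
  rw [Real.dist_eq, abs_of_nonneg (by linarith)]
  linarith

/-- In dimension one `V_A(x)` is a half-line. -/
lemma penaltyDist_one (H : Penalty h ψ) {B : Set Ω} (hB : B.Nonempty) (x : Fin 1 → Ω) :
    penaltyDist h ψ {y | y 0 ∈ B} x = ψ (penaltyToSet h (x 0) B) := by
  have hlow : ∀ s ∈ penaltyHull h {y | y 0 ∈ B} x, penaltyToSet h (x 0) B ≤ s 0 := by
    intro s hs
    have hconv : Convex ℝ {s : Fin 1 → ℝ | penaltyToSet h (x 0) B ≤ s 0} :=
      convex_halfSpace_ge (f := fun s : Fin 1 → ℝ => s 0) (LinearMap.proj 0).isLinear _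
    refine convexHull_min ?_ hconv hs
    rintro s ⟨-, y, hy, hys⟩
    exact (H.toSet_le (x 0) hy).trans (hys 0)
  have hmem : ∀ y ∈ B, (fun _ => h (x 0) y) ∈ penaltyHull h {y | y 0 ∈ B} x := by
    intro y hy
    refine subset_convexHull ℝ _ ⟨fun _ => H.nonneg _ _, fun _ => y, hy, fun i => ?_⟩
    rw [Subsingleton.elim i 0]
  have hb : BddBelow ((fun s : Fin 1 → ℝ => ∑ i, ψ (s i)) '' penaltyHull h {y | y 0 ∈ B} x) :=
    ⟨0, by rintro _ ⟨s, -, rfl⟩; exact Finset.sum_nonneg fun i _ => H.psi_nonneg _⟩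
  obtain ⟨y₀, hy₀⟩ := hB
  apply le_antisymm
  · refine le_of_forall_gt fun T hT => ?_
    obtain ⟨y, hy, hyT⟩ := H.exists_psi_lt ⟨y₀, hy₀⟩ hT
    refine (csInf_le hb (mem_image_of_mem _ (hmem y hy))).trans_lt ?_
    simpa using hyT
  · refine le_csInf ⟨_, mem_image_of_mem _ (hmem y₀ hy₀)⟩ ?_
    rintro _ ⟨s, hs, rfl⟩
    simp only [Finset.univ_unique, Fin.default_eq_zero, Finset.sum_singleton]
    exact H.psi_mono (H.toSet_nonneg _ _) ((H.toSet_nonneg _ _).trans (hlow s hs)) (hlow s hs)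

lemma aemeasurable_psi_toSet [MeasurableSpace Ω] {μ : Measure Ω} [IsProbabilityMeasure μ]
    (H : Penalty h ψ) (hm : PenaltyMeasurable μ h ψ) {B : Set Ω} (hB : MeasurableSet B)
    (hne : B.Nonempty) : AEMeasurable (fun x => ψ (penaltyToSet h x B)) μ := by
  have h1 := hm 1 {y | y 0 ∈ B} (hB.preimage (measurable_pi_apply 0))
  have hmp := (measurePreserving_funUnique μ (Fin 1)).symm
  have h2 := h1.comp_quasiMeasurePreserving hmp.quasiMeasurePreserving
  refine h2.congr (Eventually.of_forall fun x => ?_)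
  simp only [Function.comp]
  rw [H.penaltyDist_one hne]
  rfl

end Penalty

/-! ### The one-dimensional inequality: set-up -/

/-- The one-dimensional isoperimetric hypotheses on `(Ω, μ)`. -/
structure Isoperimetry {Ω : Type*} [MeasurableSpace Ω] (μ : Measure Ω) (h : Ω → Ω → ℝ)
    (ψ w : ℝ → ℝ) (γ : ℝ) : Prop where
  penalty : Penalty h ψ
  measurable : PenaltyMeasurable μ h ψ
  gamma_pos : 0 < γ
  half : γ ≤ w (1 / 2)
  nonneg : ∀ u ∈ Ioc (0 : ℝ) 1, 0 ≤ w u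
  anti : AntitoneOn w (Ioc 0 1)
  sq_le : ∫⁻ u in Ioc (0 : ℝ) 1, ENNReal.ofReal (w u ^ 2) ≤ 1
  small : ∀ B : Set Ω, MeasurableSet B → 0 < μ.real B → μ.real B ≤ 1 / 2 →
    ∫⁻ x, ENNReal.ofReal (Real.exp (ψ (penaltyToSet h x B))) ∂μ
      ≤ ENNReal.ofReal (Real.exp (w (μ.real B)))
  large : ∀ B : Set Ω, MeasurableSet B → 1 / 2 ≤ μ.real B → ∀ t : ℝ, 1 ≤ t →
    μ {x | t ≤ ψ (penaltyToSet h x B)} ≤ ENNReal.ofReal (Real.exp (-t) * (1 - μ.real B))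

/-- The inequalities that relate the partial integrals `G ω` of `exp (f / K)` to the values
`g ω = θ (P (A(ω)))`, truncated at `L`: the points `ω` with `g ω = L` include those whose section
is negligible, and carry no information of their own. -/
structure Transport {Ω : Type*} [MeasurableSpace Ω] (μ : Measure Ω) (h : Ω → Ω → ℝ)
    (ψ : ℝ → ℝ) (K L : ℝ) (G g : Ω → ℝ) : Prop where
  aemeasurable : AEMeasurable G μ
  one_le : ∀ ω, 1 ≤ G ω
  bounded : ∃ C, ∀ ω, G ω ≤ C
  measurable : Measurable g
  nonneg : ∀ ω, 0 ≤ g ω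
  le : ∀ ω, g ω ≤ L
  jump : ∀ ω ω', g ω' < L → G ω ≤ Real.exp (ψ (h ω ω') / K + g ω')
  interpolate : ∀ ω ω' s, 0 ≤ s → s ≤ 1 → g ω < L → g ω' < L →
    G ω ≤ Real.exp (ψ (s * h ω ω') / K + (1 - s) * g ω + s * g ω')

section

variable {Ω : Type*} [MeasurableSpace Ω] {μ : Measure Ω}
  {h : Ω → Ω → ℝ} {ψ w : ℝ → ℝ} {γ K L : ℝ} {G g : Ω → ℝ}

namespace Transport

lemma integrable [IsProbabilityMeasure μ] (T : Transport μ h ψ K L G g) : Integrable G μ := by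
  obtain ⟨C, hC⟩ := T.bounded
  refine Integrable.of_bound T.aemeasurable.aestronglyMeasurable C (Eventually.of_forall fun ω => ?_)
  rw [Real.norm_of_nonneg (by linarith [T.one_le ω])]
  exact hC ω

lemma one_le_integral [IsProbabilityMeasure μ] (T : Transport μ h ψ K L G g) : 1 ≤ ∫ ω, G ω ∂μ := by
  have := integral_mono (μ := μ) (integrable_const 1) T.integrable T.one_le
  simpa using this

lemma measurableSet_level (T : Transport μ h ψ K L G g) (a : ℝ) : MeasurableSet {ω | g ω ≤ a} :=
  T.measurable measurableSet_Iic

lemma le_exp_toSet (T : Transport μ h ψ K L G g) (P : Penalty h ψ) (hK : 0 < K) {a : ℝ}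
    (ha : a < L) (hne : {ω | g ω ≤ a}.Nonempty) (ω : Ω) :
    G ω ≤ Real.exp (ψ (penaltyToSet h ω {ω | g ω ≤ a}) / K + a) := by
  have hG : 0 < G ω := by linarith [T.one_le ω]
  rw [← Real.log_le_iff_le_exp hG]
  refine le_of_forall_pos_le_add fun ε hε => ?_
  obtain ⟨y, hy, hlt⟩ := P.exists_psi_lt hne
    (show ψ (penaltyToSet h ω {ω | g ω ≤ a}) < ψ (penaltyToSet h ω {ω | g ω ≤ a}) + K * ε by
      nlinarith)
  have h1 := T.jump ω y (lt_of_le_of_lt hy ha)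
  rw [← Real.log_le_iff_le_exp hG] at h1
  have h2 : ψ (h ω y) / K ≤ ψ (penaltyToSet h ω {ω | g ω ≤ a}) / K + ε := by
    rw [div_add' _ _ _ hK.ne', div_le_div_iff_of_pos_right hK]; linarith
  have h3 : g y ≤ a := hy
  linarith

/-- Convexity of the exponential allows to pass from `ψ` to `ψ / K` in the hypothesis on the sets
of measure at most `1 / 2`. -/
lemma integral_le_of_small [IsProbabilityMeasure μ] (T : Transport μ h ψ K L G g) (I : Isoperimetry μ h ψ w γ)
    (hK : 1 ≤ K) {a : ℝ} (ha : a < L) (h0 : 0 < μ.real {ω | g ω ≤ a})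
    (h1 : μ.real {ω | g ω ≤ a} ≤ 1 / 2) :
    ∫ ω, G ω ∂μ ≤ Real.exp (a + w (μ.real {ω | g ω ≤ a}) / K) := by
  have hK0 : 0 < K := by linarith
  set B := {ω | g ω ≤ a} with hBdef
  have hB := T.measurableSet_level a
  have hne : B.Nonempty := nonempty_of_measureReal_ne_zero h0.ne'
  set W := w (μ.real B)
  have hv := I.penalty.aemeasurable_psi_toSet I.measurable hB hne
  have hs := I.small B hB h0 h1
  have hm : AEStronglyMeasurable (fun x => Real.exp (ψ (penaltyToSet h x B))) μ :=
    (Real.measurable_exp.comp_aemeasurable hv).aestronglyMeasurable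
  have hint : Integrable (fun x => Real.exp (ψ (penaltyToSet h x B))) μ := by
    refine ⟨hm, ?_⟩
    rw [hasFiniteIntegral_iff_ofReal (Eventually.of_forall fun x => (Real.exp_pos _).le)]
    exact hs.trans_lt ENNReal.ofReal_lt_top
  have hle : ∫ x, Real.exp (ψ (penaltyToSet h x B)) ∂μ ≤ Real.exp W := by
    rw [integral_eq_lintegral_of_nonneg_ae (Eventually.of_forall fun x => (Real.exp_pos _).le) hm]
    exact ENNReal.toReal_le_of_le_ofReal (Real.exp_pos _).le hs
  have hpt : ∀ ω, G ω ≤ Real.exp (a + W / K) *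
      ((1 - 1 / K) + 1 / K * Real.exp (-W) * Real.exp (ψ (penaltyToSet h ω B))) := by
    intro ω
    refine (T.le_exp_toSet I.penalty hK0 ha hne ω).trans ?_
    have hc := convexOn_exp.2 (mem_univ 0) (mem_univ (ψ (penaltyToSet h ω B) - W))
      (show 0 ≤ 1 - 1 / K by rw [sub_nonneg, div_le_one hK0]; exact hK)
      (show 0 ≤ 1 / K by positivity) (by ring)
    simp only [smul_eq_mul, mul_zero, zero_add, Real.exp_zero, mul_one] at hc
    have e1 : ψ (penaltyToSet h ω B) / K + a
        = (a + W / K) + 1 / K * (ψ (penaltyToSet h ω B) - W) := by ring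
    have e2 : 1 / K * Real.exp (-W) * Real.exp (ψ (penaltyToSet h ω B))
        = 1 / K * Real.exp (ψ (penaltyToSet h ω B) - W) := by
      rw [mul_assoc, ← Real.exp_add]; congr 2; ring
    rw [e1, e2, Real.exp_add]
    exact mul_le_mul_of_nonneg_left hc (Real.exp_pos _).le
  refine (integral_mono T.integrable
    (((integrable_const _).add (hint.const_mul _)).const_mul _) hpt).trans ?_
  rw [integral_const_mul, integral_add' (integrable_const _) (hint.const_mul _),
    integral_const_mul]
  simp only [integral_const, probReal_univ, smul_eq_mul, one_mul]
  refine mul_le_of_le_one_right (Real.exp_pos _).le ?_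
  have h2 : 1 / K * Real.exp (-W) * ∫ x, Real.exp (ψ (penaltyToSet h x B)) ∂μ ≤ 1 / K := by
    calc _ ≤ 1 / K * Real.exp (-W) * Real.exp W :=
          mul_le_mul_of_nonneg_left hle (by positivity)
      _ = 1 / K := by rw [mul_assoc, ← Real.exp_add]; simp
  linarith

end Transport

namespace Isoperimetry

lemma gamma_le (I : Isoperimetry μ h ψ w γ) {u : ℝ} (h0 : 0 < u) (h1 : u ≤ 1 / 2) : γ ≤ w u :=
  I.half.trans (I.anti ⟨h0, by linarith⟩ ⟨by norm_num, by norm_num⟩ h1)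

/-- The distance of `g` below `b`, when bounded by multiples of `w`, has moments bounded by
those of `w`. -/
lemma lintegral_below_le [IsProbabilityMeasure μ] (I : Isoperimetry μ h ψ w γ) (hg : Measurable g) {b c t : ℝ}
    (hab : ∀ ω, g ω < b → 0 < μ.real {ω' | g ω' ≤ g ω} →
      b - g ω ≤ c + t * w (μ.real {ω' | g ω' ≤ g ω})) (ht : 0 ≤ t)
    {Φ : ℝ → ℝ} (hΦ : MonotoneOn Φ (Ici 0)) (hΦ0 : ∀ x, 0 ≤ x → 0 ≤ Φ x) (hc : 0 ≤ c) :
    ∫⁻ ω, ENNReal.ofReal ({ω | g ω < b}.indicator (fun ω => Φ (b - g ω)) ω) ∂μ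
      ≤ ∫⁻ u in Ioc (0 : ℝ) 1, ENNReal.ofReal (Φ (c + t * w u)) := by
  have hmem : ∀ u ∈ Ioc (0 : ℝ) 1, 0 ≤ c + t * w u := fun u hu =>
    add_nonneg hc (mul_nonneg ht (I.nonneg u hu))
  refine le_trans (lintegral_mono_ae ?_) (lintegral_levelMass_le hg (μ := μ)
    (F := fun u => Φ (c + t * w u)) ?_ fun u hu => hΦ0 _ (hmem u hu))
  · filter_upwards [ae_levelMass_pos (μ := μ) (g := g)] with ω hω
    refine ENNReal.ofReal_le_ofReal ?_
    by_cases hlt : g ω < b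
    · rw [indicator_of_mem (by exact hlt)]
      have := hab ω hlt hω
      exact hΦ (show (0 : ℝ) ≤ b - g ω by linarith)
        (show (0 : ℝ) ≤ _ by linarith) this
    · rw [indicator_of_notMem (by exact hlt)]
      exact hΦ0 _ (hmem _ ⟨hω, measureReal_le_one⟩)
  · intro u hu v hv huv
    exact hΦ (hmem v hv) (hmem u hu)
      (add_le_add_right (mul_le_mul_of_nonneg_left (I.anti hu hv huv) ht) _)

lemma integral_sq_below_le [IsProbabilityMeasure μ] (I : Isoperimetry μ h ψ w γ) (hg : Measurable g) {b t : ℝ}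
    (hab : ∀ ω, g ω < b → 0 < μ.real {ω' | g ω' ≤ g ω} →
      b - g ω ≤ t * w (μ.real {ω' | g ω' ≤ g ω})) (ht : 0 ≤ t) :
    ∫ ω, {ω | g ω < b}.indicator (fun ω => (b - g ω) ^ 2) ω ∂μ ≤ t ^ 2 := by
  have hn : ∀ ω, 0 ≤ {ω | g ω < b}.indicator (fun ω => (b - g ω) ^ 2) ω := fun ω =>
    indicator_nonneg (fun _ _ => sq_nonneg _) _
  rw [integral_eq_lintegral_of_nonneg_ae (Eventually.of_forall hn)
    ((Measurable.indicator (by fun_prop) (measurableSet_lt hg measurable_const)).aestronglyMeasurable)]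
  refine ENNReal.toReal_le_of_le_ofReal (sq_nonneg t) ?_
  refine (I.lintegral_below_le (μ := μ) hg (c := 0) (by simpa using hab) ht
    (Φ := fun x => x ^ 2) (fun x hx y hy hxy => pow_le_pow_left₀ hx hxy 2)
    (fun x _ => sq_nonneg x) le_rfl).trans ?_
  calc ∫⁻ u in Ioc (0 : ℝ) 1, ENNReal.ofReal ((0 + t * w u) ^ 2)
      = ∫⁻ u in Ioc (0 : ℝ) 1, ENNReal.ofReal (t ^ 2) * ENNReal.ofReal (w u ^ 2) := by
        refine lintegral_congr fun u => ?_
        rw [zero_add, mul_pow, ENNReal.ofReal_mul (sq_nonneg t)]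
    _ = ENNReal.ofReal (t ^ 2) * ∫⁻ u in Ioc (0 : ℝ) 1, ENNReal.ofReal (w u ^ 2) :=
        lintegral_const_mul' _ _ ENNReal.ofReal_ne_top
    _ ≤ ENNReal.ofReal (t ^ 2) := mul_le_of_le_one_right zero_le I.sq_le

lemma integral_bigXi_below_le [IsProbabilityMeasure μ] {θ ξ : ℝ → ℝ} (H : ThetaXi θ ξ) (hH : ConditionH ξ w)
    (I : Isoperimetry μ h ψ w γ) (hg : Measurable g) {b t : ℝ} (hb : 0 ≤ b)
    (hab : ∀ ω, g ω < b → 0 < μ.real {ω' | g ω' ≤ g ω} →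
      b - g ω ≤ t * w (μ.real {ω' | g ω' ≤ g ω})) (ht : 0 ≤ t) (ht1 : t ≤ 1)
    (hm : AEStronglyMeasurable ({ω | g ω < b}.indicator (fun ω => bigXi ξ (g ω) b)) μ) :
    ∫ ω, {ω | g ω < b}.indicator (fun ω => bigXi ξ (g ω) b) ω ∂μ
      ≤ t ^ 2 * |derivOnNonneg ξ b| := by
  have hn : ∀ ω, 0 ≤ {ω | g ω < b}.indicator (fun ω => bigXi ξ (g ω) b) ω := fun ω =>
    indicator_nonneg (fun _ _ => H.bigXi_nonneg hb _) _
  rw [integral_eq_lintegral_of_nonneg_ae (Eventually.of_forall hn) hm]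
  refine ENNReal.toReal_le_of_le_ofReal (by positivity) ?_
  have h1 := I.lintegral_below_le (μ := μ) hg (c := 0) (by simpa using hab) ht
    (Φ := fun x => bigXi ξ (b - x) b)
    (fun x hx y hy hxy => H.bigXi_anti hb (by linarith) (by linarith [mem_Ici.1 hx]))
    (fun x _ => H.bigXi_nonneg hb _) le_rfl
  simp only [sub_sub_cancel, zero_add] at h1
  refine h1.trans ?_
  have hwn : ∀ u ∈ Ioc (0 : ℝ) 1, 0 ≤ t * w u := fun u hu => mul_nonneg ht (I.nonneg u hu)
  have hanti : AntitoneOn (fun u => bigXi ξ (b - t * w u) b) (Ioc 0 1) := by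
    intro u hu v hv huv
    refine H.bigXi_anti hb ?_ (by linarith [hwn v hv])
    have := mul_le_mul_of_nonneg_left (I.anti hu hv huv) ht
    linarith
  have hms := (aemeasurable_restrict_of_antitoneOn (μ := volume) measurableSet_Ioc
    hanti).aestronglyMeasurable
  have hint : Integrable (fun u => bigXi ξ (b - t * w u) b) (volume.restrict (Ioc (0 : ℝ) 1)) := by
    refine Integrable.of_bound hms (bigXi ξ 0 b)
      ((ae_restrict_iff' measurableSet_Ioc).2 (Eventually.of_forall fun u hu => ?_))
    rw [Real.norm_of_nonneg (H.bigXi_nonneg hb _)]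
    exact H.bigXi_le hb (by linarith [hwn u hu])
  rw [← ofReal_integral_eq_lintegral_ofReal hint
    (Eventually.of_forall fun u => H.bigXi_nonneg hb _)]
  refine ENNReal.ofReal_le_ofReal ?_
  have := hH b hb t ht ht1
  rwa [intervalIntegral.integral_of_le zero_le_one] at this

end Isoperimetry

end

/-! ### Linearization, and the case of a large median -/

section

variable {Ω : Type*} [MeasurableSpace Ω] {μ : Measure Ω}
  {h : Ω → Ω → ℝ} {ψ w θ ξ : ℝ → ℝ} {γ K L b : ℝ} {G g : Ω → ℝ}

lemma ThetaXi.measurable_xi_comp (H : ThetaXi θ ξ) (hg : Measurable g) (hg0 : ∀ ω, 0 ≤ g ω) :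
    Measurable fun ω => ξ (g ω) := by
  have h1 : Antitone fun x => ξ (max x 0) := fun x y hxy =>
    H.xi_strictAnti.antitoneOn (mem_Ici.2 (le_max_right _ _)) (mem_Ici.2 (le_max_right _ _))
      (max_le_max_right 0 hxy)
  have e : (fun ω => ξ (g ω)) = (fun x => ξ (max x 0)) ∘ g := by
    ext ω; simp [hg0 ω]
  rw [e]
  exact h1.measurable.comp hg

lemma ThetaXi.integrable_xi_comp [IsProbabilityMeasure μ] (H : ThetaXi θ ξ) (hg : Measurable g)
    (hg0 : ∀ ω, 0 ≤ g ω) : Integrable (fun ω => ξ (g ω)) μ := by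
  refine Integrable.of_bound (H.measurable_xi_comp hg hg0).aestronglyMeasurable 1
    (Eventually.of_forall fun ω => ?_)
  have := H.xi_maps (hg0 ω)
  rw [Real.norm_of_nonneg this.1.le]
  exact this.2

lemma ThetaXi.integrable_bigXi_below [IsProbabilityMeasure μ] (H : ThetaXi θ ξ)
    (hg : Measurable g) (hg0 : ∀ ω, 0 ≤ g ω) (hb : 0 ≤ b) :
    Integrable ({ω | g ω < b}.indicator (fun ω => bigXi ξ (g ω) b)) μ := by
  have hm : Measurable fun ω => bigXi ξ (g ω) b := by
    have := H.measurable_xi_comp hg hg0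
    have e : (fun ω => bigXi ξ (g ω) b)
        = fun ω => ξ (g ω) - ξ b - (g ω - b) * derivOnNonneg ξ b := by
      ext ω; rw [ThetaXi.bigXi_of_nonneg (hg0 ω)]
    rw [e]
    exact (this.sub_const _).sub ((hg.sub_const _).mul_const _)
  refine Integrable.of_bound
    (hm.indicator (measurableSet_lt hg measurable_const)).aestronglyMeasurable (bigXi ξ 0 b)
    (Eventually.of_forall fun ω => ?_)
  by_cases hlt : g ω < b
  · rw [indicator_of_mem (by exact hlt), Real.norm_of_nonneg (H.bigXi_nonneg hb _)]
    exact H.bigXi_le hb hlt.le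
  · rw [indicator_of_notMem (by exact hlt), norm_zero]
    exact H.bigXi_nonneg hb _

lemma integrable_below [IsProbabilityMeasure μ] (hg : Measurable g) (hg0 : ∀ ω, 0 ≤ g ω)
    (hb : 0 ≤ b) : Integrable ({ω | g ω < b}.indicator (fun ω => b - g ω)) μ := by
  refine Integrable.of_bound ((Measurable.indicator (by fun_prop)
    (measurableSet_lt hg measurable_const)).aestronglyMeasurable) b
    (Eventually.of_forall fun ω => ?_)
  by_cases hlt : g ω < b
  · rw [indicator_of_mem (by exact hlt), Real.norm_of_nonneg (by linarith)]
    linarith [hg0 ω]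
  · rw [indicator_of_notMem (by exact hlt), norm_zero]
    exact hb

/-- It suffices to prove the linearization at some `b` of the one-dimensional inequality. -/
lemma ThetaXi.integral_le_of_linearized (H : ThetaXi θ ξ) (hb : 0 ≤ b) {M D : ℝ} (hM : 0 ≤ M)
    (hle : (M - b) * |derivOnNonneg ξ b| ≤ ξ b - D) : D ≤ ξ M := by
  have h1 := H.tangent_le hb hM
  rw [H.abs_deriv hb] at hle
  linarith

lemma ThetaXi.xi_eq_of_lt (H : ThetaXi θ ξ) (hb : 0 ≤ b) {x : ℝ} (hx : 0 ≤ x) :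
    ξ b - ξ x = -(b - x) * |derivOnNonneg ξ b| - bigXi ξ x b := by
  rw [ThetaXi.bigXi_of_nonneg hx, H.abs_deriv hb]; ring

lemma Transport.log_integral_le [IsProbabilityMeasure μ] (T : Transport μ h ψ K L G g)
    (I : Isoperimetry μ h ψ w γ) (hK : 1 ≤ K) {a : ℝ} (ha : a < L)
    (h0 : 0 < μ.real {ω | g ω ≤ a}) (h1 : μ.real {ω | g ω ≤ a} ≤ 1 / 2) :
    Real.log (∫ ω, G ω ∂μ) ≤ a + w (μ.real {ω | g ω ≤ a}) / K := by
  rw [Real.log_le_iff_le_exp (by linarith [T.one_le_integral])]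
  exact T.integral_le_of_small I hK ha h0 h1

/-- Levels of `g` of mass at most `1 / 2` lie below `M + 4 / K` by at most a small multiple
of `w`. -/
lemma Transport.sub_le [IsProbabilityMeasure μ] (T : Transport μ h ψ K L G g)
    (I : Isoperimetry μ h ψ w γ) (hK : 1 ≤ K) (hL : Real.log (∫ ω, G ω ∂μ) + 5 ≤ L)
    (hbM : b ≤ Real.log (∫ ω, G ω ∂μ) + 4 / K) {a : ℝ} (hab : a < b)
    (h0 : 0 < μ.real {ω | g ω ≤ a}) (h1 : μ.real {ω | g ω ≤ a} ≤ 1 / 2) :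
    b - a ≤ 4 / K + 1 / K * w (μ.real {ω | g ω ≤ a}) ∧
    b - a ≤ (1 + 4 / γ) / K * w (μ.real {ω | g ω ≤ a}) := by
  have hK0 : 0 < K := by linarith
  have hK4 : 4 / K ≤ 4 := by rw [div_le_iff₀ hK0]; linarith
  have h2 := T.log_integral_le I hK (a := a) (by linarith) h0 h1
  have h3 : b - a ≤ 4 / K + 1 / K * w (μ.real {ω | g ω ≤ a}) := by
    rw [one_div_mul_eq_div]; linarith
  refine ⟨h3, h3.trans ?_⟩
  have hw := I.gamma_le h0 h1
  have hγ := I.gamma_pos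
  have h4 : 4 ≤ 4 / γ * w (μ.real {ω | g ω ≤ a}) := by
    rw [div_mul_eq_mul_div, le_div_iff₀ hγ]; linarith
  have h5 : (1 + 4 / γ) / K * w (μ.real {ω | g ω ≤ a})
      = 1 / K * w (μ.real {ω | g ω ≤ a}) + (4 / γ * w (μ.real {ω | g ω ≤ a})) / K := by
    field_simp
  rw [h5]
  have h6 : 4 / K ≤ (4 / γ * w (μ.real {ω | g ω ≤ a})) / K :=
    (div_le_div_iff_of_pos_right hK0).2 h4
  linarith

lemma Isoperimetry.lintegral_le_one (I : Isoperimetry μ h ψ w γ) :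
    ∫⁻ u in Ioc (0 : ℝ) 1, ENNReal.ofReal (w u) ≤ 1 := by
  calc ∫⁻ u in Ioc (0 : ℝ) 1, ENNReal.ofReal (w u)
      ≤ ∫⁻ u in Ioc (0 : ℝ) 1, (ENNReal.ofReal (1 / 2)
          + ENNReal.ofReal (1 / 2) * ENNReal.ofReal (w u ^ 2)) := by
        refine lintegral_mono fun u => ?_
        rw [← ENNReal.ofReal_mul (by norm_num), ← ENNReal.ofReal_add (by norm_num) (by positivity)]
        exact ENNReal.ofReal_le_ofReal (by nlinarith [sq_nonneg (w u - 1)])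
    _ = ENNReal.ofReal (1 / 2) + ENNReal.ofReal (1 / 2) *
          ∫⁻ u in Ioc (0 : ℝ) 1, ENNReal.ofReal (w u ^ 2) := by
        rw [lintegral_add_left measurable_const, lintegral_const_mul' _ _ ENNReal.ofReal_ne_top]
        simp
    _ ≤ ENNReal.ofReal (1 / 2) + ENNReal.ofReal (1 / 2) * 1 := by
        gcongr; exact I.sq_le
    _ = 1 := by
        rw [mul_one, ← ENNReal.ofReal_add (by norm_num) (by norm_num)]; norm_num

/-- If the median of `g` exceeds `M + 4 / K`, where `M = log ∫ G`, then linearization at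
`M + 4 / K` suffices, because `g` lies below this point by at most `3 / K` on average. -/
lemma Transport.integral_xi_le_of_median_large [IsProbabilityMeasure μ]
    (T : Transport μ h ψ K L G g) (I : Isoperimetry μ h ψ w γ) (H : ThetaXi θ ξ)
    (hH : ConditionH ξ w) (hK : (1 + 4 / γ) ^ 2 ≤ K) (hL : Real.log (∫ ω, G ω ∂μ) + 5 ≤ L)
    (hmed : μ.real {ω | g ω ≤ Real.log (∫ ω, G ω ∂μ) + 4 / K} < 1 / 2) :
    ∫ ω, ξ (g ω) ∂μ ≤ ξ (Real.log (∫ ω, G ω ∂μ)) := by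
  have hM : 0 ≤ Real.log (∫ ω, G ω ∂μ) := Real.log_nonneg T.one_le_integral
  have hγ := I.gamma_pos
  have hC : 1 ≤ 1 + 4 / γ := by
    have : 0 < 4 / γ := by positivity
    linarith
  have hK1 : 1 ≤ K := by nlinarith
  have hK0 : 0 < K := by linarith
  set M := Real.log (∫ ω, G ω ∂μ)
  set b := M + 4 / K with hbdef
  have hb : 0 ≤ b := by positivity
  have hg := T.measurable
  have hlev : ∀ ω, g ω < b → μ.real {ω' | g ω' ≤ g ω} ≤ 1 / 2 := fun ω hω =>
    (levelMass_mono μ g hω.le).trans hmed.le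
  have ht0 : 0 ≤ (1 + 4 / γ) / K := by positivity
  have ht1 : (1 + 4 / γ) / K ≤ 1 := by rw [div_le_one hK0]; nlinarith
  have hXi := I.integral_bigXi_below_le (μ := μ) H hH hg hb
    (fun ω hω h0 => (T.sub_le I hK1 hL le_rfl hω h0 (hlev ω hω)).2) ht0 ht1
    (H.integrable_bigXi_below hg T.nonneg hb).aestronglyMeasurable
  have hbelow : ∫ ω, {ω | g ω < b}.indicator (fun ω => b - g ω) ω ∂μ ≤ 3 / K := by
    have hn : ∀ ω, 0 ≤ {ω | g ω < b}.indicator (fun ω => max (b - g ω - 4 / K) 0) ω := fun ω =>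
      indicator_nonneg (fun _ _ => le_max_right _ _) _
    have hmset : MeasurableSet {ω | g ω < b} := measurableSet_lt hg measurable_const
    have hms : Measurable ({ω | g ω < b}.indicator (fun ω => max (b - g ω - 4 / K) 0)) :=
      Measurable.indicator (by fun_prop) hmset
    have h1 : ∫ ω, {ω | g ω < b}.indicator (fun ω => max (b - g ω - 4 / K) 0) ω ∂μ ≤ 1 / K := by
      rw [integral_eq_lintegral_of_nonneg_ae (Eventually.of_forall hn) hms.aestronglyMeasurable]
      refine ENNReal.toReal_le_of_le_ofReal (by positivity) ?_
      refine (I.lintegral_below_le (μ := μ) hg (c := 4 / K) (t := 1 / K) (b := b)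
        (fun ω hω h0 => (T.sub_le I hK1 hL le_rfl hω h0 (hlev ω hω)).1) (by positivity)
        (Φ := fun x => max (x - 4 / K) 0)
        (fun x _ y _ hxy => max_le_max_right 0 (by linarith)) (fun x _ => le_max_right _ _)
        (by positivity)).trans ?_
      calc ∫⁻ u in Ioc (0 : ℝ) 1, ENNReal.ofReal (max (4 / K + 1 / K * w u - 4 / K) 0)
          ≤ ∫⁻ u in Ioc (0 : ℝ) 1, ENNReal.ofReal (1 / K) * ENNReal.ofReal (w u) := by
            refine lintegral_mono fun u => ?_
            rw [← ENNReal.ofReal_mul (by positivity), add_sub_cancel_left]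
            refine ENNReal.ofReal_le_of_le_toReal ?_
            rw [ENNReal.toReal_ofReal']
        _ = ENNReal.ofReal (1 / K) * ∫⁻ u in Ioc (0 : ℝ) 1, ENNReal.ofReal (w u) :=
            lintegral_const_mul' _ _ ENNReal.ofReal_ne_top
        _ ≤ ENNReal.ofReal (1 / K) := mul_le_of_le_one_right zero_le I.lintegral_le_one
    have hint1 : Integrable ({ω | g ω < b}.indicator (fun ω => max (b - g ω - 4 / K) 0)) μ := by
      refine Integrable.of_bound hms.aestronglyMeasurable b (Eventually.of_forall fun ω => ?_)
      rw [Real.norm_of_nonneg (hn ω)]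
      refine indicator_apply_le' (fun _ => max_le ?_ hb) (fun _ => hb)
      have := T.nonneg ω
      have : 0 < 4 / K := by positivity
      linarith
    have hint2 : Integrable ({ω | g ω < b}.indicator (fun _ => 4 / K)) μ :=
      (integrable_const _).indicator hmset
    have h2 : ∫ ω, {ω | g ω < b}.indicator (fun _ => 4 / K) ω ∂μ ≤ 2 / K := by
      rw [integral_indicator_const _ hmset, smul_eq_mul]
      have : μ.real {ω | g ω < b} ≤ 1 / 2 :=
        (measureReal_mono (show {ω | g ω < b} ⊆ {ω | g ω ≤ b} from
          fun ω (hω : g ω < b) => hω.le)).trans hmed.le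
      calc μ.real {ω | g ω < b} * (4 / K) ≤ 1 / 2 * (4 / K) :=
            mul_le_mul_of_nonneg_right this (by positivity)
        _ = 2 / K := by ring
    have h3 := integral_mono (integrable_below hg T.nonneg hb) (hint2.add hint1) (fun ω => by
      by_cases hlt : g ω < b
      · simp only [Pi.add_apply]
        rw [indicator_of_mem (by exact hlt), indicator_of_mem (by exact hlt),
          indicator_of_mem (by exact hlt)]
        linarith [le_max_left (b - g ω - 4 / K) 0]
      · simp only [Pi.add_apply]
        rw [indicator_of_notMem (by exact hlt), indicator_of_notMem (by exact hlt),
          indicator_of_notMem (by exact hlt), add_zero])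
    rw [integral_add' hint2 hint1] at h3
    have : 3 / K = 2 / K + 1 / K := by ring
    linarith
  refine H.integral_le_of_linearized hb hM ?_
  have hpt : ∀ ω, ξ (g ω) ≤ ξ b
      + |derivOnNonneg ξ b| * {ω | g ω < b}.indicator (fun ω => b - g ω) ω
      + {ω | g ω < b}.indicator (fun ω => bigXi ξ (g ω) b) ω := by
    intro ω
    by_cases hlt : g ω < b
    · rw [indicator_of_mem (by exact hlt), indicator_of_mem (by exact hlt)]
      linarith [H.xi_eq_of_lt hb (T.nonneg ω)]
    · rw [indicator_of_notMem (by exact hlt), indicator_of_notMem (by exact hlt)]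
      have := H.xi_strictAnti.antitoneOn (show (0 : ℝ) ≤ b from hb) (T.nonneg ω) (not_lt.1 hlt)
      linarith
  have hi1 := (integrable_below (μ := μ) hg T.nonneg hb).const_mul |derivOnNonneg ξ b|
  have hi2 := H.integrable_bigXi_below (μ := μ) hg T.nonneg hb
  have h4 := integral_mono (H.integrable_xi_comp (μ := μ) hg T.nonneg)
    (((integrable_const (ξ b)).add hi1).add hi2) hpt
  rw [integral_add' ((integrable_const (ξ b)).add hi1) hi2,
    integral_add' (integrable_const (ξ b)) hi1, integral_const_mul] at h4
  simp only [integral_const, probReal_univ, smul_eq_mul, one_mul] at h4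
  have h5 : ((1 + 4 / γ) / K) ^ 2 ≤ 1 / K := by
    rw [div_pow, div_le_div_iff₀ (by positivity) hK0]; nlinarith
  have hd := abs_nonneg (derivOnNonneg ξ b)
  have h6 := mul_le_mul_of_nonneg_left hbelow hd
  have h7 := mul_le_mul_of_nonneg_right h5 hd
  have h8 : M - b = -(3 / K) - 1 / K := by rw [hbdef]; ring
  rw [h8]
  linarith

end

/-! ### Scalar estimates -/

lemma exp_le_one_add_add_sq {x : ℝ} (h0 : -1 ≤ x) (h1 : x ≤ 1) : Real.exp x ≤ 1 + x + x ^ 2 := by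
  have := (abs_le.1 (Real.abs_exp_sub_one_sub_id_le (abs_le.2 ⟨h0, h1⟩))).2
  linarith

lemma exp_neg_le_quadratic {y : ℝ} (hy : 0 ≤ y) : Real.exp (-y) ≤ 1 - y + y ^ 2 / 2 := by
  have h1 := Real.quadratic_le_exp_of_nonneg hy
  have h2 : 0 < 1 + y + y ^ 2 / 2 := by positivity
  rw [Real.exp_neg]
  refine (inv_anti₀ h2 h1).trans ?_
  rw [inv_le_iff_one_le_mul₀ h2]
  nlinarith [sq_nonneg (y ^ 2)]

/-- Just above the level `b`, the second-order loss is at most `2 δ ^ 2` and a gain `z` in the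
exponent is kept up to a factor `2`. -/
lemma sub_one_le_of_gain {δ z x : ℝ} (h0 : 0 ≤ δ) (h1 : δ ≤ 1 / 8) (hz0 : 0 ≤ z)
    (hz1 : z ≤ 1 / 2) (hx : x ≤ Real.exp (δ - z)) :
    x - 1 ≤ 1 - Real.exp (-δ) + 2 * δ ^ 2 - z / 2 := by
  have e1 := exp_le_one_add_add_sq (x := δ) (by linarith) (by linarith)
  have e2 := exp_le_one_add_add_sq (x := -δ) (by linarith) (by linarith)
  have e3 := exp_le_one_add_add_sq (x := -z) (by linarith) (by linarith)
  have e4 := Real.one_le_exp h0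
  rw [sub_eq_add_neg, Real.exp_add] at hx
  have e5 : Real.exp (-z) ≤ 1 - z / 2 := by nlinarith
  have e6 : Real.exp δ * Real.exp (-z) ≤ Real.exp δ * (1 - z / 2) :=
    mul_le_mul_of_nonneg_left e5 (by linarith)
  nlinarith

/-- At a point at height `δ` above `b` that can be joined, at bounded penalty, to a level of height
at most `δ / 2`, the gain from interpolation dominates the second-order loss. -/
lemma sub_one_le_of_near {δ K x : ℝ} (h0 : 0 < δ) (h1 : δ ≤ 1 / 8) (hK : 1000000 ≤ K)
    (hjump : x ≤ Real.exp (20 / K + δ / 2))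
    (hint : ∀ s : ℝ, 0 ≤ s → s * 20 ≤ 1 →
      x ≤ Real.exp (s ^ 2 * 20 ^ 2 / K + (1 - s) * δ + s * (δ / 2))) :
    x - 1 ≤ 1 - Real.exp (-δ) - δ ^ 2 / 2 := by
  have hK0 : 0 < K := by linarith
  rcases le_total 160 (K * δ) with hc | hc
  · have h20 : 20 / K ≤ δ / 8 := by rw [div_le_iff₀ hK0]; linarith
    have e1 := hjump.trans (Real.exp_le_exp.2 (show 20 / K + δ / 2 ≤ 5 / 8 * δ by linarith))
    have e2 := exp_le_one_add_add_sq (x := 5 / 8 * δ) (by linarith) (by linarith)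
    have e3 := exp_le_one_add_add_sq (x := -δ) (by linarith) (by linarith)
    nlinarith
  · -- This `s` is half the minimizer `K δ / 1600` of the exponent, hence at most `1 / 20` here.
    have hs := hint (K * δ / 3200) (by positivity) (by linarith)
    have e1 : (K * δ / 3200) ^ 2 * 20 ^ 2 / K + (1 - K * δ / 3200) * δ + K * δ / 3200 * (δ / 2)
        = δ - 3 * K * δ ^ 2 / 25600 := by field_simp; ring
    rw [e1] at hs
    have e2 := sub_one_le_of_gain h0.le h1 (z := 3 * K * δ ^ 2 / 25600) (by positivity)
      (by nlinarith) hs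
    nlinarith [sq_nonneg δ]

lemma sub_one_le_of_far {δ K x : ℝ} (h1 : 1 / 8 ≤ δ) (hK : 1000000 ≤ K)
    (hjump : x ≤ Real.exp (20 / K + 1 / 16)) : x - 1 ≤ 1 - Real.exp (-δ) - 1 / 25 := by
  have hK0 : 0 < K := by linarith
  have h20 : 20 / K ≤ 1 / 50000 := by rw [div_le_iff₀ hK0]; linarith
  have e1 := hjump.trans (Real.exp_le_exp.2 (show 20 / K + 1 / 16 ≤ 1 / 50000 + 1 / 16 by linarith))
  have e2 := exp_le_one_add_add_sq (x := 1 / 50000 + 1 / 16) (by norm_num) (by norm_num)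
  have e3 := exp_le_one_add_add_sq (x := -(1 / 8)) (by norm_num) (by norm_num)
  have e4 : Real.exp (-δ) ≤ Real.exp (-(1 / 8)) := Real.exp_le_exp.2 (by linarith)
  norm_num at e1 e2
  linarith

lemma exp_le_two_mul_pow {K v : ℝ} (hK : 1000000 ≤ K) {j : ℕ} (hj : v ≤ j + 1) :
    Real.exp (v / K + 1 / 16) ≤ 2 * (5 / 4) ^ j := by
  have hK0 : 0 < K := by linarith
  have h1 : v / K ≤ (j + 1) * (1 / 5) := by
    rw [div_le_iff₀ hK0]
    have : (0 : ℝ) ≤ j := Nat.cast_nonneg j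
    nlinarith
  have h2 : Real.exp (1 / 5) ≤ 5 / 4 := by
    have := exp_le_one_add_add_sq (x := 1 / 5) (by norm_num) (by norm_num)
    linarith
  have h3 : Real.exp (1 / 5 + 1 / 16) ≤ 2 := by
    have := exp_le_one_add_add_sq (x := 1 / 5 + 1 / 16) (by norm_num) (by norm_num)
    linarith
  calc Real.exp (v / K + 1 / 16) ≤ Real.exp ((1 / 5 + 1 / 16) + j * (1 / 5)) :=
        Real.exp_le_exp.2 (by linarith)
    _ = Real.exp (1 / 5 + 1 / 16) * Real.exp (1 / 5) ^ j := by
        rw [Real.exp_add, Real.exp_nat_mul]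
    _ ≤ 2 * (5 / 4) ^ j := by gcongr

lemma exp_neg_one_le : Real.exp (-1) ≤ 2 / 5 := by
  rw [Real.exp_neg, inv_le_comm₀ (Real.exp_pos 1) (by norm_num)]
  linarith [Real.exp_one_gt_d9]

lemma exp_neg_natCast_le (n : ℕ) : Real.exp (-n) ≤ (2 / 5) ^ n := by
  have : Real.exp (-n) = Real.exp (-1) ^ n := by rw [← Real.exp_nat_mul]; ring_nf
  rw [this]
  exact pow_le_pow_left₀ (Real.exp_pos _).le exp_neg_one_le n

/-- Scaling gives this bound for the dyadic sum of `4 ^ (-k)` over the `k` with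
`2 ^ (-k) < 32 d`. -/
lemma sum_dyadic_le (n : ℕ) (d : ℝ) :
    ∑ k ∈ Finset.range n, (if (1 / 2 : ℝ) ^ (k + 5) < d then (1 / 4 : ℝ) ^ k else 0)
      ≤ 2048 * d ^ 2 := by
  induction n generalizing d with
  | zero => simp; positivity
  | succ n ih =>
    by_cases hd : (1 / 2 : ℝ) ^ 5 < d
    · calc _ ≤ ∑ k ∈ Finset.range (n + 1), (1 / 4 : ℝ) ^ k := by
            refine Finset.sum_le_sum fun k _ => ?_
            split_ifs
            · exact le_rfl
            · positivity
        _ ≤ 2 := by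
            rw [geom_sum_eq (by norm_num), div_le_iff_of_neg (by norm_num)]
            have : (0 : ℝ) < (1 / 4) ^ (n + 1) := by positivity
            linarith
        _ ≤ 2048 * d ^ 2 := by norm_num at hd; nlinarith
    · rw [Finset.sum_range_succ']
      have h1 : ∀ k ∈ Finset.range n,
          (if (1 / 2 : ℝ) ^ (k + 1 + 5) < d then (1 / 4 : ℝ) ^ (k + 1) else 0)
          = 1 / 4 * (if (1 / 2 : ℝ) ^ (k + 5) < 2 * d then (1 / 4 : ℝ) ^ k else 0) := by
        intro k _
        have : (1 / 2 : ℝ) ^ (k + 1 + 5) < d ↔ (1 / 2 : ℝ) ^ (k + 5) < 2 * d := by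
          rw [show k + 1 + 5 = (k + 5) + 1 by ring, pow_succ]
          constructor <;> intro h <;> linarith
        simp only [this]
        split_ifs
        · rw [pow_succ]; ring
        · ring
      rw [Finset.sum_congr rfl h1, ← Finset.mul_sum, zero_add, if_neg hd]
      have := ih (2 * d)
      linarith

/-- Each `δ ∈ (0, 1 / 8]` lies in a dyadic interval. -/
lemma exists_dyadic {δ : ℝ} (h0 : 0 < δ) (h1 : δ ≤ 1 / 8) :
    ∃ k : ℕ, (1 / 2 : ℝ) ^ (k + 4) < δ ∧ δ ≤ (1 / 2 : ℝ) ^ (k + 3) := by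
  obtain ⟨n, hn1, hn2⟩ := exists_nat_pow_near_of_lt_one (x := 8 * δ) (y := (1 / 2 : ℝ))
    (by linarith) (by linarith) (by norm_num) (by norm_num)
  refine ⟨n, ?_, ?_⟩
  · rw [show n + 4 = (n + 1) + 3 by ring, pow_add]; norm_num at hn1 ⊢; linarith
  · rw [pow_add]; norm_num at hn2 ⊢; linarith

/-! ### The case of a small median: auxiliary sets -/

section

variable {Ω : Type*} {mΩ : MeasurableSpace Ω} {μ : Measure Ω}
  {h : Ω → Ω → ℝ} {ψ w θ ξ : ℝ → ℝ} {γ K L b : ℝ} {G g : Ω → ℝ}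

/-- A median of `g`, below any level of mass at least `1 / 2`. -/
lemma exists_median [IsProbabilityMeasure μ] (hg : Measurable g) (hg0 : ∀ ω, 0 ≤ g ω) {c : ℝ}
    (hc : 1 / 2 ≤ μ.real {ω | g ω ≤ c}) :
    ∃ b, 0 ≤ b ∧ b ≤ c ∧ 1 / 2 ≤ μ.real {ω | g ω ≤ b} ∧ μ.real {ω | g ω < b} ≤ 1 / 2 := by
  set S : Set ℝ := {a | 1 / 2 ≤ μ.real {ω | g ω ≤ a}} with hS
  have hS0 : ∀ a ∈ S, 0 ≤ a := by
    intro a ha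
    by_contra! hneg
    have : {ω | g ω ≤ a} = ∅ := by
      ext ω
      simp only [mem_ofPred_eq, mem_empty_iff_false, iff_false, not_le]
      linarith [hg0 ω]
    have ha' : 1 / 2 ≤ μ.real {ω | g ω ≤ a} := ha
    rw [this, measureReal_empty] at ha'
    norm_num at ha'
  have hbdd : BddBelow S := ⟨0, hS0⟩
  have hne : S.Nonempty := ⟨c, hc⟩
  have cover : ∀ (E : Set Ω) (F : ℕ → Set Ω), Monotone F → E ⊆ ⋃ n, F n →
      (∀ n, μ.real (F n) ≤ 1 / 2) → μ.real E ≤ 1 / 2 := by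
    intro E F hF hE hn
    refine ENNReal.toReal_le_of_le_ofReal (by norm_num) ?_
    refine (measure_mono hE).trans ?_
    rw [hF.measure_iUnion]
    refine iSup_le fun n => ?_
    rw [← ofReal_measureReal]
    exact ENNReal.ofReal_le_ofReal (hn n)
  have hcompl : ∀ a, μ.real {ω | a < g ω} = 1 - μ.real {ω | g ω ≤ a} := by
    intro a
    rw [← probReal_compl_eq_one_sub (measurableSet_le hg measurable_const)]
    congr 1
    ext ω
    simp
  refine ⟨sInf S, Real.sInf_nonneg hS0, csInf_le hbdd hc, ?_, ?_⟩
  · obtain ⟨z, hz, hzs, hzt⟩ := exists_seq_strictAnti_tendsto (sInf S)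
    have := cover {ω | sInf S < g ω} (fun n => {ω | z n < g ω})
      (fun i j hij ω (hω : z i < g ω) => lt_of_le_of_lt (hz.antitone hij) hω) (fun ω hω => by
        obtain ⟨n, hn⟩ := (hzt.eventually (gt_mem_nhds hω)).exists
        exact mem_iUnion.2 ⟨n, hn⟩) (fun n => by
        obtain ⟨y, hy, hyn⟩ := exists_lt_of_csInf_lt hne (hzs n)
        have h1 : 1 / 2 ≤ μ.real {ω | g ω ≤ z n} :=
          le_trans (show 1 / 2 ≤ μ.real {ω | g ω ≤ y} from hy) (levelMass_mono μ g hyn.le)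
        rw [hcompl]; linarith)
    rw [hcompl] at this
    linarith
  · obtain ⟨z, hz, hzs, hzt⟩ := exists_seq_strictMono_tendsto (sInf S)
    exact cover {ω | g ω < sInf S} (fun n => {ω | g ω ≤ z n})
      (fun i j hij ω (hω : g ω ≤ z i) => hω.trans (hz.monotone hij)) (fun ω hω => by
        obtain ⟨n, hn⟩ := (hzt.eventually (lt_mem_nhds hω)).exists
        exact mem_iUnion.2 ⟨n, hn.le⟩) (fun n => by
        by_contra! hn
        exact absurd (csInf_le hbdd (show z n ∈ S from hn.le)) (not_le.2 (hzs n)))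

/-- The smallest `t` such that `g` lies below `b` by at most `t` times `w`; if not zero, it is
attained up to a factor `2`. -/
lemma exists_optimal_scale {C : ℝ} (hC : 0 ≤ C) {u : Ω → ℝ}
    (hw : ∀ ω, g ω < b → 0 < u ω → 0 < w (u ω))
    (hle : ∀ ω, g ω < b → 0 < u ω → b - g ω ≤ C * w (u ω)) :
    ∃ t, 0 ≤ t ∧ t ≤ C ∧ (∀ ω, g ω < b → 0 < u ω → b - g ω ≤ t * w (u ω)) ∧
      (t = 0 ∨ ∃ ω, g ω < b ∧ 0 < u ω ∧ t / 2 * w (u ω) ≤ b - g ω) := by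
  set R : Set ℝ := (fun ω => (b - g ω) / w (u ω)) '' {ω | g ω < b ∧ 0 < u ω} with hR
  have hRC : ∀ r ∈ R, r ≤ C := by
    rintro _ ⟨ω, ⟨h1, h2⟩, rfl⟩
    exact (div_le_iff₀ (hw ω h1 h2)).2 (hle ω h1 h2)
  have hR0 : ∀ r ∈ R, 0 ≤ r := by
    rintro _ ⟨ω, ⟨h1, h2⟩, rfl⟩
    exact div_nonneg (by linarith) (hw ω h1 h2).le
  have hbdd : BddAbove R := ⟨C, hRC⟩
  refine ⟨sSup R, Real.sSup_nonneg hR0, Real.sSup_le hRC hC, fun ω h1 h2 => ?_, ?_⟩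
  · rw [← div_le_iff₀ (hw ω h1 h2)]
    exact le_csSup hbdd ⟨ω, ⟨h1, h2⟩, rfl⟩
  · rcases R.eq_empty_or_nonempty with he | hne
    · left; rw [he, Real.sSup_empty]
    rcases (Real.sSup_nonneg hR0).eq_or_lt with h0 | h0
    · exact Or.inl h0.symm
    right
    obtain ⟨_, ⟨ω, ⟨h1, h2⟩, rfl⟩, hlt⟩ := exists_lt_of_lt_csSup hne
      (show sSup R / 2 < sSup R by linarith)
    exact ⟨ω, h1, h2, ((lt_div_iff₀ (hw ω h1 h2)).1 hlt).le⟩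

/-- By Markov's inequality most points above the median are at moderate penalty from a given level
set of mass `u ≤ 1 / 2`. -/
lemma exists_good_above [IsProbabilityMeasure μ] (I : Isoperimetry μ h ψ w γ) (hg : Measurable g)
    (hb : μ.real {ω | g ω < b} ≤ 1 / 2) {B : Set Ω} (hB : MeasurableSet B) (h0 : 0 < μ.real B)
    (h1 : μ.real B ≤ 1 / 2) :
    ∃ S, MeasurableSet S ∧ 1 / 4 ≤ μ.real S ∧
      ∀ ω ∈ S, b ≤ g ω ∧ ψ (penaltyToSet h ω B) < w (μ.real B) + 2 := by
  have hne : B.Nonempty := nonempty_of_measureReal_ne_zero h0.ne'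
  have hv := I.penalty.aemeasurable_psi_toSet I.measurable hB hne
  set W := w (μ.real B)
  set E := {ω | ENNReal.ofReal (Real.exp (W + 2)) ≤
    ENNReal.ofReal (Real.exp (ψ (penaltyToSet h ω B)))} with hE
  have hE1 : μ E ≤ ENNReal.ofReal (1 / 4) := by
    refine (meas_ge_le_lintegral_div ((Real.measurable_exp.comp_aemeasurable hv).ennreal_ofReal)
      (by simp [Real.exp_pos]) ENNReal.ofReal_ne_top).trans ?_
    refine (ENNReal.div_le_div_right (I.small B hB h0 h1) _).trans ?_
    rw [← ENNReal.ofReal_div_of_pos (Real.exp_pos _), ← Real.exp_sub]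
    refine ENNReal.ofReal_le_ofReal ?_
    have e1 := exp_neg_natCast_le 2
    have e2 : w (μ.real B) - (W + 2) = -((2 : ℕ) : ℝ) := by
      push_cast; simp only [W]; ring
    rw [e2]
    refine e1.trans ?_
    norm_num
  have hlow : MeasurableSet {ω | b ≤ g ω} := measurableSet_le measurable_const hg
  refine ⟨{ω | b ≤ g ω} \ toMeasurable μ E, hlow.diff (measurableSet_toMeasurable _ _), ?_, ?_⟩
  · have e1 : 1 / 2 ≤ μ.real {ω | b ≤ g ω} := by
      have e2 : {ω | b ≤ g ω} = {ω | g ω < b}ᶜ := by ext ω; simp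
      rw [e2, probReal_compl_eq_one_sub (measurableSet_lt hg measurable_const)]
      linarith
    have e3 : μ.real (toMeasurable μ E) ≤ 1 / 4 := by
      refine ENNReal.toReal_le_of_le_ofReal (by norm_num) ?_
      rwa [measure_toMeasurable]
    have e4 := le_measureReal_sdiff (μ := μ) (s₁ := {ω | b ≤ g ω}) (s₂ := toMeasurable μ E)
    linarith
  · rintro ω ⟨hω, hωE⟩
    refine ⟨hω, ?_⟩
    by_contra! hc
    refine hωE (subset_toMeasurable μ E ?_)
    exact ENNReal.ofReal_le_ofReal (Real.exp_le_exp.2 hc)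

/-- The points at large penalty from `B` form a set of small measure compared to `Bᶜ`. -/
lemma Isoperimetry.measure_toMeasurable_le [IsProbabilityMeasure μ] (I : Isoperimetry μ h ψ w γ) {B : Set Ω}
    (hB : MeasurableSet B) (h1 : 1 / 2 ≤ μ.real B) {n : ℕ} (hn : 1 ≤ n) :
    μ (toMeasurable μ {x | (n : ℝ) ≤ ψ (penaltyToSet h x B)})
      ≤ ENNReal.ofReal ((2 / 5) ^ n) * μ Bᶜ := by
  rw [measure_toMeasurable, ← ofReal_measureReal (s := Bᶜ), probReal_compl_eq_one_sub hB,
    ← ENNReal.ofReal_mul (by positivity)]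
  refine (I.large B hB h1 n (by exact_mod_cast hn)).trans (ENNReal.ofReal_le_ofReal ?_)
  exact mul_le_mul_of_nonneg_right (exp_neg_natCast_le n)
    (by linarith [measureReal_le_one (μ := μ) (s := B)])

/-- The error made above the median `b` of `g` by points that are at large penalty from the levels
below them: a dyadic sum for the points at height at most `1 / 8` above `b`, and a sum over integer
values of the penalty for the others. -/
noncomputable def farError (μ : Measure Ω) (h : Ω → Ω → ℝ) (ψ : ℝ → ℝ) (g : Ω → ℝ) (b : ℝ) (ω : Ω) : ENNReal :=
  ∑' k : ℕ, (toMeasurable μ {x | ((20 : ℕ) : ℝ) ≤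
      ψ (penaltyToSet h x {ω' | g ω' ≤ b + (1 / 2) ^ (k + 5)})}).indicator
        (fun _ => ENNReal.ofReal (3 / 64 * (1 / 4) ^ k)) ω
  + ∑' j : ℕ, (toMeasurable μ {x | ((j + 20 : ℕ) : ℝ) ≤
      ψ (penaltyToSet h x {ω' | g ω' ≤ b + 1 / 16})}).indicator
        (fun _ => ENNReal.ofReal (2 * (5 / 4) ^ (j + 20))) ω

lemma measurable_farError : Measurable (farError μ h ψ g b) := by
  refine Measurable.add ?_ ?_ <;>
  exact Measurable.tsum fun k =>
    measurable_const.indicator (measurableSet_toMeasurable _ _)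

/-- The height above `b`, truncated at `1 / 8`. -/
noncomputable def truncHeight (g : Ω → ℝ) (b : ℝ) (ω : Ω) : ℝ := max (min (g ω - b) (1 / 8)) 0

lemma measurable_truncHeight (hg : Measurable g) : Measurable (truncHeight g b) := by
  unfold truncHeight; fun_prop

lemma lintegral_farError_le [IsProbabilityMeasure μ] (I : Isoperimetry μ h ψ w γ) (hg : Measurable g)
    (hb : 1 / 2 ≤ μ.real {ω | g ω ≤ b}) :
    ∫⁻ ω, farError μ h ψ g b ω ∂μ
      ≤ ENNReal.ofReal (2 / 9) * ∫⁻ ω, ENNReal.ofReal (truncHeight g b ω ^ 2) ∂μ := by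
  have hlev : ∀ c, MeasurableSet {ω | g ω ≤ c} := fun c => hg measurableSet_Iic
  have hmass : ∀ c, b ≤ c → 1 / 2 ≤ μ.real {ω | g ω ≤ c} := fun c hc =>
    hb.trans (levelMass_mono μ g hc)
  have hd := measurable_truncHeight (b := b) hg
  set D := ∫⁻ ω, ENNReal.ofReal (truncHeight g b ω ^ 2) ∂μ with hD
  have hmem : ∀ c : ℝ, 0 < c → c < 1 / 8 → ∀ ω, ω ∈ {ω | g ω ≤ b + c}ᶜ ↔ c < truncHeight g b ω := by
    intro c h0 h1 ω
    simp only [mem_compl_iff, mem_ofPred_eq, not_le, truncHeight, lt_max_iff, lt_min_iff]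
    constructor
    · intro h2; exact Or.inl ⟨by linarith, h1⟩
    · rintro (⟨h2, -⟩ | h2)
      · linarith
      · linarith
  have hpow : ∀ k : ℕ, (1 / 2 : ℝ) ^ (k + 5) < 1 / 8 := by
    intro k
    have : (1 / 2 : ℝ) ^ (k + 5) ≤ (1 / 2) ^ 5 :=
      pow_le_pow_of_le_one (by norm_num) (by norm_num) (by omega)
    refine this.trans_lt (by norm_num)
  have hA : ∫⁻ ω, ∑' k : ℕ, (toMeasurable μ {x | ((20 : ℕ) : ℝ) ≤
      ψ (penaltyToSet h x {ω' | g ω' ≤ b + (1 / 2) ^ (k + 5)})}).indicator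
        (fun _ => ENNReal.ofReal (3 / 64 * (1 / 4) ^ k)) ω ∂μ ≤ ENNReal.ofReal (1 / 9) * D := by
    rw [lintegral_tsum fun k =>
      (measurable_const.indicator (measurableSet_toMeasurable _ _)).aemeasurable]
    calc _ ≤ ∑' k : ℕ, ∫⁻ ω, ENNReal.ofReal (3 / 64 * (2 / 5) ^ 20) *
            ENNReal.ofReal (if (1 / 2 : ℝ) ^ (k + 5) < truncHeight g b ω
              then (1 / 4 : ℝ) ^ k else 0) ∂μ := by
          refine ENNReal.tsum_le_tsum fun k => ?_
          rw [lintegral_indicator_const (measurableSet_toMeasurable _ _)]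
          refine (mul_le_mul_right (I.measure_toMeasurable_le (hlev _)
            (hmass _ (by linarith [show (0 : ℝ) < (1 / 2) ^ (k + 5) by positivity]))
            (by norm_num)) _).trans ?_
          rw [← lintegral_indicator_one (hlev _).compl, ← mul_assoc,
            ← ENNReal.ofReal_mul (by positivity), ← lintegral_const_mul' _ _ ENNReal.ofReal_ne_top]
          refine lintegral_mono fun ω => ?_
          simp only
          by_cases hω : ω ∈ {ω | g ω ≤ b + (1 / 2) ^ (k + 5)}ᶜ
          · rw [indicator_of_mem hω, if_pos ((hmem _ (by positivity) (hpow k) ω).1 hω),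
              ← ENNReal.ofReal_mul (by positivity), Pi.one_apply, mul_one]
            exact ENNReal.ofReal_le_ofReal (by linarith)
          · rw [indicator_of_notMem hω, mul_zero]
            exact zero_le
      _ = ∫⁻ ω, ENNReal.ofReal (3 / 64 * (2 / 5) ^ 20) * ∑' k : ℕ,
            ENNReal.ofReal (if (1 / 2 : ℝ) ^ (k + 5) < truncHeight g b ω
              then (1 / 4 : ℝ) ^ k else 0) ∂μ := by
          rw [← lintegral_tsum]
          · simp_rw [ENNReal.tsum_mul_left]
          · intro k
            refine ((Measurable.ite (measurableSet_lt measurable_const hd) measurable_const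
              measurable_const).ennreal_ofReal.const_mul _).aemeasurable
      _ ≤ ∫⁻ ω, ENNReal.ofReal (1 / 9) * ENNReal.ofReal (truncHeight g b ω ^ 2) ∂μ := by
          refine lintegral_mono fun ω => ?_
          calc _ ≤ ENNReal.ofReal (3 / 64 * (2 / 5) ^ 20) *
                ENNReal.ofReal (2048 * truncHeight g b ω ^ 2) := by
                gcongr
                refine ENNReal.tsum_le_of_sum_range_le fun n => ?_
                rw [← ENNReal.ofReal_sum_of_nonneg fun k _ => by split_ifs <;> positivity]
                exact ENNReal.ofReal_le_ofReal (sum_dyadic_le n _)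
            _ ≤ _ := by
                rw [← ENNReal.ofReal_mul (by positivity), ← ENNReal.ofReal_mul (by positivity)]
                refine ENNReal.ofReal_le_ofReal ?_
                rw [← mul_assoc]
                exact mul_le_mul_of_nonneg_right (by norm_num) (sq_nonneg _)
      _ = _ := lintegral_const_mul' _ _ ENNReal.ofReal_ne_top
  have hB : ∫⁻ ω, ∑' j : ℕ, (toMeasurable μ {x | ((j + 20 : ℕ) : ℝ) ≤
      ψ (penaltyToSet h x {ω' | g ω' ≤ b + 1 / 16})}).indicator
        (fun _ => ENNReal.ofReal (2 * (5 / 4) ^ (j + 20))) ω ∂μ ≤ ENNReal.ofReal (1 / 9) * D := by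
    rw [lintegral_tsum fun k =>
      (measurable_const.indicator (measurableSet_toMeasurable _ _)).aemeasurable]
    have hmark : μ {ω | g ω ≤ b + 1 / 16}ᶜ ≤ ENNReal.ofReal 256 * D := by
      rw [← lintegral_indicator_one (hlev _).compl, ← lintegral_const_mul' _ _ ENNReal.ofReal_ne_top]
      refine lintegral_mono fun ω => ?_
      simp only
      by_cases hω : ω ∈ {ω | g ω ≤ b + 1 / 16}ᶜ
      · rw [indicator_of_mem hω, ← ENNReal.ofReal_mul (by norm_num), Pi.one_apply,
          ← ENNReal.ofReal_one]
        have := (hmem _ (by norm_num) (by norm_num) ω).1 hω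
        exact ENNReal.ofReal_le_ofReal (by nlinarith)
      · rw [indicator_of_notMem hω]
        exact zero_le
    calc _ ≤ ∑' j : ℕ, ENNReal.ofReal (2 * (1 / 2) ^ 20 * (1 / 2) ^ j)
          * (ENNReal.ofReal 256 * D) := by
          refine ENNReal.tsum_le_tsum fun j => ?_
          rw [lintegral_indicator_const (measurableSet_toMeasurable _ _)]
          refine (mul_le_mul_right (I.measure_toMeasurable_le (hlev _)
            (hmass _ (by linarith)) (by omega)) _).trans ?_
          rw [← mul_assoc, ← ENNReal.ofReal_mul (by positivity)]
          refine mul_le_mul' (le_of_eq ?_) hmark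
          rw [mul_assoc, ← mul_pow, mul_assoc, ← pow_add, add_comm 20 j]
          norm_num
      _ = ENNReal.ofReal (4 * (1 / 2) ^ 20) * (ENNReal.ofReal 256 * D) := by
          rw [ENNReal.tsum_mul_right, ← ENNReal.ofReal_tsum_of_nonneg (fun j => by positivity)
            (summable_geometric_two.mul_left _), tsum_mul_left, tsum_geometric_two]
          norm_num
      _ ≤ _ := by
          rw [← mul_assoc, ← ENNReal.ofReal_mul (by positivity)]
          gcongr
          norm_num
  unfold farError
  rw [lintegral_add_left (Measurable.tsum fun k =>
    measurable_const.indicator (measurableSet_toMeasurable _ _))]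
  refine (add_le_add hA hB).trans ?_
  rw [← add_mul, ← ENNReal.ofReal_add (by norm_num) (by norm_num)]
  norm_num

end

/-! ### The case of a small median: pointwise estimates -/

section

variable {Ω : Type*} {mΩ : MeasurableSpace Ω} {μ : Measure Ω}
  {h : Ω → Ω → ℝ} {ψ w θ ξ : ℝ → ℝ} {γ K L b : ℝ} {G g : Ω → ℝ}

lemma mul_exp_neg_le {x c : ℝ} (hx : x ≤ Real.exp c) (b : ℝ) :
    x * Real.exp (-b) ≤ Real.exp (c - b) := by
  rw [sub_eq_add_neg, Real.exp_add]
  exact mul_le_mul_of_nonneg_right hx (Real.exp_pos _).le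

/-- A point at penalty less than `20` from a level set can be interpolated with that level. -/
lemma Transport.le_of_near (T : Transport μ h ψ K L G g) (P : Penalty h ψ) (hK : 0 < K) {a : ℝ}
    (ha : a < L) (hne : {ω | g ω ≤ a}.Nonempty) {ω : Ω}
    (hω : ψ (penaltyToSet h ω {ω | g ω ≤ a}) < 20) :
    G ω ≤ Real.exp (20 / K + a) ∧ (g ω < L → ∀ s : ℝ, 0 ≤ s → s * 20 ≤ 1 →
      G ω ≤ Real.exp (s ^ 2 * 20 ^ 2 / K + (1 - s) * g ω + s * a)) := by
  obtain ⟨y, hy, hlt⟩ := P.exists_psi_lt hne hω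
  have hy' : g y ≤ a := hy
  have hyL := hy'.trans_lt ha
  refine ⟨(T.jump ω y hyL).trans (Real.exp_le_exp.2 ?_), fun hL s hs hs20 =>
    (T.interpolate ω y s hs (by linarith) hL hyL).trans (Real.exp_le_exp.2 ?_)⟩
  · have := (div_le_div_iff_of_pos_right hK).2 hlt.le
    linarith
  · have h1 := P.psi_mul_le hs (P.nonneg ω y) (P.lt_of_psi_lt (by norm_num) hlt).le hs20
    have h2 := (div_le_div_iff_of_pos_right hK).2 h1
    have h3 := mul_le_mul_of_nonneg_left hy' hs
    linarith

/-- The gain in the exponent at a point above `b` that is at penalty at most `w + 2` from the level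
`a`, when `b - a ≥ t w / 2`. -/
lemma Transport.le_of_below (T : Transport μ h ψ K L G g) (P : Penalty h ψ) (hγ : 0 < γ)
    (hK : 1000000 * (1 + 2 / γ) ^ 2 ≤ K) {a t W : ℝ}
    (ht0 : 0 ≤ t) (htK : t ≤ (1 + 4 / γ) / K) (hW : γ ≤ W) (hab : t / 2 * W ≤ b - a) (ha : a < L)
    (hne : {ω | g ω ≤ a}.Nonempty) {ω : Ω} (hω : ψ (penaltyToSet h ω {ω | g ω ≤ a}) < W + 2)
    (hb : b ≤ g ω) (hL : g ω < L) :
    G ω ≤ Real.exp (g ω - 108 * t ^ 2) := by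
  obtain ⟨y, hy, hlt⟩ := P.exists_psi_lt hne hω
  have hy' : g y ≤ a := hy
  have hW0 : 0 < W := hγ.trans_le hW
  set c := 1 + 2 / γ with hc
  have hc1 : 1 < c := by
    have : 0 < 2 / γ := by positivity
    linarith
  have hγc : γ * c = γ + 2 := by rw [hc]; field_simp
  have hc4 : 1 + 4 / γ ≤ 2 * c := by
    have : 4 / γ = 2 * (2 / γ) := by ring
    linarith
  have hK0 : 0 < K := lt_of_lt_of_le (by positivity) hK
  have hcW : W + 2 ≤ c * W := by
    have : 2 ≤ 2 / γ * W := by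
      rw [div_mul_eq_mul_div, le_div_iff₀ hγ]; linarith
    rw [hc]; linarith
  have hh : h ω y ≤ c * W := (P.lt_of_psi_lt (by linarith) hlt).le.trans hcW
  have htK' : t * K ≤ 2 * c := ((le_div_iff₀ hK0).1 htK).trans hc4
  have htc : 217 * t * c ≤ 1 := by
    have h1 : t * (1000000 * c ^ 2) ≤ 2 * c := (mul_le_mul_of_nonneg_left hK ht0).trans htK'
    have h2 : (1000000 * t * c) * c ≤ 2 * c := by linarith
    have h3 := le_of_mul_le_mul_right h2 (by linarith)
    linarith
  -- With this `s` the linear gain is `217 t ^ 2 / 2`, half of `t ^ 2` more than claimed; the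
  -- quadratic cost fits into the difference as `K` is large.
  set s := 217 * t / W with hs
  have hs0 : 0 ≤ s := by positivity
  have hsW : s * W = 217 * t := by rw [hs]; field_simp
  have hsc : s * (c * W) ≤ 1 := by
    have : s * (c * W) = 217 * t * c := by rw [mul_left_comm, hsW]; ring
    linarith
  have hs1 : s ≤ 1 := by
    have : 1 ≤ c * W := by
      have := mul_le_mul_of_nonneg_left hW (by linarith : (0 : ℝ) ≤ c)
      linarith
    nlinarith
  refine (T.interpolate ω y s hs0 hs1 hL (hy'.trans_lt ha)).trans (Real.exp_le_exp.2 ?_)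
  have h1 := (div_le_div_iff_of_pos_right hK0).2 (P.psi_mul_le hs0 (P.nonneg ω y) hh hsc)
  have h2 : s ^ 2 * (c * W) ^ 2 / K ≤ t ^ 2 / 2 := by
    have : s ^ 2 * (c * W) ^ 2 = (217 * t * c) ^ 2 := by
      rw [← mul_pow, mul_left_comm, hsW]; ring
    rw [this, div_le_iff₀ hK0]
    nlinarith [mul_le_mul_of_nonneg_left hK (sq_nonneg t), sq_nonneg (t * c)]
  have h3 : s * (g ω - g y) ≥ 217 * t ^ 2 / 2 := by
    have h4 : t / 2 * W ≤ g ω - g y := by linarith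
    have h5 := mul_le_mul_of_nonneg_left h4 hs0
    have h6 : s * (t / 2 * W) = 217 * t ^ 2 / 2 := by
      rw [mul_left_comm, hsW]; ring
    linarith
  linarith

lemma le_farError_dyadic {ω : Ω} (hfin : farError μ h ψ g b ω ≠ ⊤) {k : ℕ}
    (hω : 20 ≤ ψ (penaltyToSet h ω {ω' | g ω' ≤ b + (1 / 2) ^ (k + 5)})) :
    3 / 64 * (1 / 4) ^ k ≤ (farError μ h ψ g b ω).toReal := by
  rw [← ENNReal.ofReal_le_iff_le_toReal hfin]
  refine le_trans ?_ le_self_add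
  refine le_trans ?_ (ENNReal.le_tsum k)
  rw [indicator_of_mem]
  refine subset_toMeasurable μ _ ?_
  simpa using hω

lemma le_farError_integer {ω : Ω} (hfin : farError μ h ψ g b ω ≠ ⊤) {j : ℕ} (hj : 20 ≤ j)
    (hω : j ≤ ψ (penaltyToSet h ω {ω' | g ω' ≤ b + 1 / 16})) :
    2 * (5 / 4) ^ j ≤ (farError μ h ψ g b ω).toReal := by
  obtain ⟨i, rfl⟩ := Nat.exists_eq_add_of_le' hj
  rw [← ENNReal.ofReal_le_iff_le_toReal hfin]
  refine le_trans ?_ le_add_self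
  refine le_trans ?_ (ENNReal.le_tsum i)
  rw [indicator_of_mem]
  exact subset_toMeasurable μ _ hω

lemma truncHeight_of_le {ω : Ω} (h0 : b ≤ g ω) (h1 : g ω ≤ b + 1 / 8) :
    truncHeight g b ω = g ω - b := by
  rw [truncHeight, min_eq_left (by linarith), max_eq_left (by linarith)]

lemma truncHeight_of_ge {ω : Ω} (h1 : b + 1 / 8 ≤ g ω) : truncHeight g b ω = 1 / 8 := by
  rw [truncHeight, min_eq_right (by linarith), max_eq_left (by norm_num)]

lemma truncHeight_of_lt {ω : Ω} (h1 : g ω < b) : truncHeight g b ω = 0 := by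
  rw [truncHeight, max_eq_right ((min_le_left _ _).trans (by linarith))]

/-- The pointwise inequality above the median: on the set `S` there is a first-order gain `z`,
elsewhere a gain quadratic in the height, up to the error from far points. -/
lemma Transport.sub_one_le_above (T : Transport μ h ψ K L G g) (P : Penalty h ψ)
    (hK : 1000000 ≤ K) (hbL : b + 1 / 8 < L) (hne : {ω | g ω ≤ b}.Nonempty)
    {S : Set Ω} {z : ℝ} (hz0 : 0 ≤ z) (hz1 : z ≤ 1 / 4)
    (hS : ∀ ω ∈ S, g ω < L → G ω ≤ Real.exp (g ω - z)) {ω : Ω} (hω : b ≤ g ω)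
    (hfin : farError μ h ψ g b ω ≠ ⊤) :
    G ω * Real.exp (-b) - 1 ≤ 1 - Real.exp (b - g ω) - z / 18 * S.indicator 1 ω
      - 2 / 9 * truncHeight g b ω ^ 2 + (farError μ h ψ g b ω).toReal := by
  have hK0 : 0 < K := by linarith
  have hF : 0 ≤ (farError μ h ψ g b ω).toReal := ENNReal.toReal_nonneg
  have hne' : ∀ c : ℝ, b ≤ c → {ω | g ω ≤ c}.Nonempty := fun c hc =>
    hne.mono fun ω (hω : g ω ≤ b) => hω.trans hc
  have hind : S.indicator (1 : Ω → ℝ) ω ≤ 1 := indicator_apply_le' (fun _ => le_rfl) (fun _ => zero_le_one)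
  have hind' : z / 18 * S.indicator (1 : Ω → ℝ) ω ≤ z / 18 :=
    mul_le_of_le_one_right (by positivity) hind
  rcases le_or_gt (g ω) (b + 1 / 8) with hlow | hhigh
  · have hL : g ω < L := hlow.trans_lt hbL
    rw [truncHeight_of_le hω hlow, show b - g ω = -(g ω - b) by ring]
    set δ := g ω - b with hδ
    have hδ0 : 0 ≤ δ := by linarith
    have hδ1 : δ ≤ 1 / 8 := by linarith
    -- The bound from `S`; off `S` it holds with `z` replaced by `0`.
    have hself : G ω ≤ Real.exp (g ω) := by
      have := T.interpolate ω ω 0 le_rfl zero_le_one hL hL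
      simpa [P.zero] using this
    have hgain : G ω * Real.exp (-b) - 1
        ≤ 1 - Real.exp (-δ) + 2 * δ ^ 2 - z / 2 * S.indicator (1 : Ω → ℝ) ω := by
      by_cases hωS : ω ∈ S
      · rw [indicator_of_mem hωS, Pi.one_apply, mul_one]
        refine sub_one_le_of_gain hδ0 hδ1 hz0 (by linarith) ?_
        have := mul_exp_neg_le (hS ω hωS hL) b
        rwa [show g ω - z - b = δ - z by rw [hδ]; ring] at this
      · rw [indicator_of_notMem hωS, mul_zero]
        have := sub_one_le_of_gain hδ0 hδ1 le_rfl (by norm_num)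
          (x := G ω * Real.exp (-b)) (by simpa using mul_exp_neg_le hself b)
        linarith
    have hind0 : 0 ≤ z * S.indicator (1 : Ω → ℝ) ω :=
      mul_nonneg hz0 (indicator_nonneg (fun _ _ => zero_le_one) _)
    rcases hδ0.eq_or_lt with h0 | h0
    · rw [← h0] at hgain ⊢
      linarith
    obtain ⟨k, hk1, hk2⟩ := exists_dyadic h0 hδ1
    have hℓ : (1 / 2 : ℝ) ^ (k + 5) ≤ δ / 2 := by
      rw [show k + 5 = (k + 4) + 1 by ring, pow_succ]; linarith
    have hℓ0 : (0 : ℝ) < (1 / 2) ^ (k + 5) := by positivity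
    by_cases hnear : ψ (penaltyToSet h ω {ω' | g ω' ≤ b + (1 / 2) ^ (k + 5)}) < 20
    · obtain ⟨hj, hi⟩ := T.le_of_near P hK0 (a := b + (1 / 2) ^ (k + 5)) (by linarith)
        (hne' _ (by linarith)) hnear
      have := sub_one_le_of_near h0 hδ1 hK (x := G ω * Real.exp (-b))
        ((mul_exp_neg_le hj b).trans (Real.exp_le_exp.2 (by linarith)))
        (fun s hs hs20 => (mul_exp_neg_le (hi hL s hs hs20) b).trans (Real.exp_le_exp.2 (by
          have := mul_le_mul_of_nonneg_left hℓ hs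
          rw [hδ] at this ⊢
          linarith)))
      linarith
    · have h1 := le_farError_dyadic hfin (not_lt.1 hnear)
      have h2 : 3 * δ ^ 2 ≤ 3 / 64 * (1 / 4) ^ k := by
        have h3 : δ ^ 2 ≤ ((1 / 2 : ℝ) ^ (k + 3)) ^ 2 := pow_le_pow_left₀ hδ0 hk2 2
        have h4 : ((1 / 2 : ℝ) ^ (k + 3)) ^ 2 = 1 / 64 * (1 / 4) ^ k := by
          rw [← pow_mul, mul_comm, pow_mul, pow_add]; norm_num; ring
        linarith
      have h3 := sq_nonneg δ
      linarith
  · rw [truncHeight_of_ge hhigh.le]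
    have hexp : Real.exp (b - g ω) ≤ 1 := Real.exp_le_one_iff.2 (by linarith)
    by_cases hnear : ψ (penaltyToSet h ω {ω' | g ω' ≤ b + 1 / 16}) < 20
    · obtain ⟨hj, -⟩ := T.le_of_near P hK0 (a := b + 1 / 16) (by linarith)
        (hne' _ (by linarith)) hnear
      have := sub_one_le_of_far (δ := g ω - b) (by linarith) hK (x := G ω * Real.exp (-b))
        ((mul_exp_neg_le hj b).trans (Real.exp_le_exp.2 (by linarith)))
      rw [neg_sub] at this
      linarith
    · rw [not_lt] at hnear
      set v := ψ (penaltyToSet h ω {ω' | g ω' ≤ b + 1 / 16})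
      have hj := T.le_exp_toSet P hK0 (a := b + 1 / 16) (by linarith) (hne' _ (by linarith)) ω
      have h1 := le_farError_integer hfin (j := ⌊v⌋₊) (Nat.le_floor (by exact_mod_cast hnear))
        (Nat.floor_le (by linarith))
      have h2 := exp_le_two_mul_pow hK (Nat.lt_floor_add_one v).le
      have h3 := (mul_exp_neg_le hj b).trans
        (Real.exp_le_exp.2 (show v / K + (b + 1 / 16) - b ≤ v / K + 1 / 16 by linarith))
      linarith

end

/-! ### The one-dimensional inequality -/

section

variable {Ω : Type*} {mΩ : MeasurableSpace Ω} {μ : Measure Ω}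
  {h : Ω → Ω → ℝ} {ψ w θ ξ : ℝ → ℝ} {γ K L b : ℝ} {G g : Ω → ℝ}

/-- When the level `b` is not far above `M`, the depth of `g` below `b`, measured in terms of `w`,
produces a comparable gain on a quarter of the space, above `b`. -/
lemma Transport.exists_gain [IsProbabilityMeasure μ] (T : Transport μ h ψ K L G g)
    (I : Isoperimetry μ h ψ w γ) (hK : 1000000 * (1 + 2 / γ) ^ 2 ≤ K)
    (hL : Real.log (∫ ω, G ω ∂μ) + 5 ≤ L) (hbM : b ≤ Real.log (∫ ω, G ω ∂μ) + 4 / K)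
    (hb : μ.real {ω | g ω < b} ≤ 1 / 2) :
    ∃ t, 0 ≤ t ∧ t ≤ (1 + 4 / γ) / K ∧
      (∀ ω, g ω < b → 0 < μ.real {ω' | g ω' ≤ g ω} →
        b - g ω ≤ t * w (μ.real {ω' | g ω' ≤ g ω})) ∧
      ∃ S, MeasurableSet S ∧ 1 / 4 ≤ μ.real S ∧ (∀ ω ∈ S, b ≤ g ω) ∧
        ∀ ω ∈ S, g ω < L → G ω ≤ Real.exp (g ω - 108 * t ^ 2) := by
  have hγ := I.gamma_pos
  have hK1 : 1 ≤ K := by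
    have : 0 < 2 / γ := by positivity
    nlinarith
  have hK0 : 0 < K := by linarith
  have hg := T.measurable
  have hlev : ∀ ω, g ω < b → μ.real {ω' | g ω' ≤ g ω} ≤ 1 / 2 := fun ω hω =>
    (measureReal_mono (show {ω' | g ω' ≤ g ω} ⊆ {ω' | g ω' < b} from
      fun ω' (h : g ω' ≤ g ω) => h.trans_lt hω)).trans hb
  obtain ⟨t, ht0, htC, hab, hopt⟩ := exists_optimal_scale (g := g) (b := b) (w := w)
    (u := fun ω => μ.real {ω' | g ω' ≤ g ω}) (C := (1 + 4 / γ) / K) (by positivity)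
    (fun ω hω h0 => hγ.trans_le (I.gamma_le h0 (hlev ω hω)))
    (fun ω hω h0 => (T.sub_le I hK1 hL hbM hω h0 (hlev ω hω)).2)
  refine ⟨t, ht0, htC, hab, ?_⟩
  rcases hopt with rfl | ⟨ω₀, h1, h2, h3⟩
  · refine ⟨{ω | b ≤ g ω}, measurableSet_le measurable_const hg, ?_, fun ω hω => hω,
      fun ω _ hωL => ?_⟩
    · have e : {ω | b ≤ g ω} = {ω | g ω < b}ᶜ := by ext ω; simp
      rw [e, probReal_compl_eq_one_sub (measurableSet_lt hg measurable_const)]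
      linarith
    · have := T.interpolate ω ω 0 le_rfl zero_le_one hωL hωL
      simpa [I.penalty.zero] using this
  · obtain ⟨S, hSm, hS1, hS2⟩ := exists_good_above I hg hb (T.measurableSet_level (g ω₀)) h2
      (hlev ω₀ h1)
    refine ⟨S, hSm, hS1, fun ω hω => (hS2 ω hω).1, fun ω hω hωL => ?_⟩
    exact T.le_of_below I.penalty hγ hK ht0 htC (I.gamma_le h2 (hlev ω₀ h1)) h3
      (h1.trans_le (hS2 ω hω).1 |>.trans hωL) ⟨ω₀, le_refl (g ω₀)⟩ (hS2 ω hω).2 (hS2 ω hω).1 hωL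

/-- If the median `b` of `g` is at most `M + 4 / K`, where `M = log ∫ G`, then linearization at `b`
suffices: the second-order losses below `b` are of order `t ^ 2`, and the gain above `b` exceeds
them. -/
lemma Transport.integral_xi_le_of_median_small [IsProbabilityMeasure μ]
    (T : Transport μ h ψ K L G g) (I : Isoperimetry μ h ψ w γ) (H : ThetaXi θ ξ)
    (hH : ConditionH ξ w) (hK : 1000000 * (1 + 2 / γ) ^ 2 ≤ K)
    (hL : Real.log (∫ ω, G ω ∂μ) + 5 ≤ L)
    (hmed : 1 / 2 ≤ μ.real {ω | g ω ≤ Real.log (∫ ω, G ω ∂μ) + 4 / K}) :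
    ∫ ω, ξ (g ω) ∂μ ≤ ξ (Real.log (∫ ω, G ω ∂μ)) := by
  have hγ := I.gamma_pos
  have hg := T.measurable
  obtain ⟨b, hb0, hbM, hb1, hb2⟩ := exists_median hg T.nonneg hmed
  obtain ⟨t, ht0, htC, hab, S, hSm, hS1, hSb, hSgain⟩ := T.exists_gain I hK hL hbM hb2
  have hM : 0 ≤ Real.log (∫ ω, G ω ∂μ) := Real.log_nonneg T.one_le_integral
  have hexpM : Real.exp (Real.log (∫ ω, G ω ∂μ)) = ∫ ω, G ω ∂μ :=
    Real.exp_log (by linarith [T.one_le_integral])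
  set M := Real.log (∫ ω, G ω ∂μ)
  have hc : 1 < 1 + 2 / γ := by
    have : 0 < 2 / γ := by positivity
    linarith
  have hK6 : 1000000 ≤ K := by nlinarith
  have hK0 : 0 < K := by linarith
  have ht : t ≤ 1 / 1000 := by
    refine htC.trans ?_
    rw [div_le_iff₀ hK0]
    have : 4 / γ = 2 * (2 / γ) := by ring
    nlinarith
  have hK4 : 4 / K ≤ 1 := by rw [div_le_one hK0]; linarith
  have hz1 : 108 * t ^ 2 ≤ 1 / 4 := by nlinarith
  have hne : {ω | g ω ≤ b}.Nonempty := nonempty_of_measureReal_ne_zero (μ := μ) (by linarith)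
  -- The three error terms.
  have hXi := I.integral_bigXi_below_le (μ := μ) H hH hg hb0 hab ht0 (by linarith)
    (H.integrable_bigXi_below hg T.nonneg hb0).aestronglyMeasurable
  have hsq := I.integral_sq_below_le (μ := μ) hg hab ht0
  have hd2 : Integrable (fun ω => truncHeight g b ω ^ 2) μ := by
    refine Integrable.of_bound ((measurable_truncHeight hg).pow_const 2).aestronglyMeasurable 1
      (Eventually.of_forall fun ω => ?_)
    have h1 : 0 ≤ truncHeight g b ω := le_max_right _ _
    have h2 : truncHeight g b ω ≤ 1 / 8 := max_le (min_le_right _ _) (by norm_num)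
    rw [Real.norm_of_nonneg (sq_nonneg _)]
    nlinarith
  have hfar := lintegral_farError_le I hg hb1
  rw [← ofReal_integral_eq_lintegral_ofReal hd2 (Eventually.of_forall fun ω => sq_nonneg _),
    ← ENNReal.ofReal_mul (by norm_num)] at hfar
  have hfin : ∫⁻ ω, farError μ h ψ g b ω ∂μ ≠ ⊤ := (hfar.trans_lt ENNReal.ofReal_lt_top).ne
  have hae := ae_lt_top measurable_farError hfin
  have hfar' : ∫ ω, (farError μ h ψ g b ω).toReal ∂μ
      ≤ 2 / 9 * ∫ ω, truncHeight g b ω ^ 2 ∂μ := by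
    rw [integral_toReal measurable_farError.aemeasurable hae]
    exact ENNReal.toReal_le_of_le_ofReal
      (mul_nonneg (by norm_num) (integral_nonneg fun ω => sq_nonneg _)) hfar
  have hfarI : Integrable (fun ω => (farError μ h ψ g b ω).toReal) μ :=
    integrable_toReal_of_lintegral_ne_top measurable_farError.aemeasurable hfin
  have hsqI : Integrable ({ω | g ω < b}.indicator (fun ω => (b - g ω) ^ 2)) μ := by
    refine Integrable.of_bound ((Measurable.indicator (by fun_prop)
      (measurableSet_lt hg measurable_const)).aestronglyMeasurable) (b ^ 2)
      (Eventually.of_forall fun ω => ?_)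
    rw [Real.norm_of_nonneg (indicator_nonneg (fun _ _ => sq_nonneg _) _)]
    refine indicator_apply_le' (fun hω => ?_) (fun _ => sq_nonneg b)
    have hω' : g ω < b := hω
    exact pow_le_pow_left₀ (by linarith) (by linarith [T.nonneg ω]) 2
  have hXiI := H.integrable_bigXi_below (μ := μ) hg T.nonneg hb0
  have hSI : Integrable (S.indicator (1 : Ω → ℝ)) μ := (integrable_const 1).indicator hSm
  have hGI := T.integrable.mul_const (Real.exp (-b))
  set D := |derivOnNonneg ξ b| with hD
  have hD0 : 0 ≤ D := abs_nonneg _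
  -- The pointwise comparison.
  have hpt : ∀ᵐ ω ∂μ, ξ (g ω) ≤ ξ b + D * ((((((farError μ h ψ g b ω).toReal
      - 2 / 9 * truncHeight g b ω ^ 2) - 108 * t ^ 2 / 18 * S.indicator (1 : Ω → ℝ) ω)
      - G ω * Real.exp (-b)) + 1)
      + 1 / 2 * {ω | g ω < b}.indicator (fun ω => (b - g ω) ^ 2) ω)
      + {ω | g ω < b}.indicator (fun ω => bigXi ξ (g ω) b) ω := by
    filter_upwards [hae] with ω hω
    rcases lt_or_ge (g ω) b with hlt | hge
    · have hmem : ω ∈ {ω | g ω < b} := hlt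
      rw [indicator_of_notMem (fun hωS => absurd (hSb ω hωS) (not_le.2 hlt)),
        indicator_of_mem hmem, indicator_of_mem hmem, truncHeight_of_lt hlt]
      have h1 := H.xi_eq_of_lt hb0 (T.nonneg ω) (b := b)
      have hωL : g ω < L := by linarith
      have h2 := T.interpolate ω ω 0 le_rfl zero_le_one hωL hωL
      simp only [zero_mul, I.penalty.zero, zero_div, sub_zero, one_mul, zero_add, add_zero] at h2
      have h3 := mul_exp_neg_le h2 b
      have h4 := exp_neg_le_quadratic (y := b - g ω) (by linarith)
      rw [neg_sub] at h4
      have h5 : 0 ≤ (farError μ h ψ g b ω).toReal := ENNReal.toReal_nonneg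
      have h6 : -(b - g ω) ≥ -(((((farError μ h ψ g b ω).toReal
          - 2 / 9 * 0 ^ 2) - 108 * t ^ 2 / 18 * 0) - G ω * Real.exp (-b)) + 1
          + 1 / 2 * (b - g ω) ^ 2) := by linarith
      have h7 := mul_le_mul_of_nonneg_left h6 hD0
      linarith
    · have hmem : ω ∉ {ω | g ω < b} := not_lt.2 hge
      rw [indicator_of_notMem hmem (fun ω => (b - g ω) ^ 2),
        indicator_of_notMem hmem (fun ω => bigXi ξ (g ω) b)]
      have h1 := H.one_sub_exp_le hb0 hge
      have h2 := T.sub_one_le_above I.penalty hK6 (b := b) (by linarith) hne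
        (S := S) (z := 108 * t ^ 2) (by positivity) hz1 hSgain hge hω.ne
      have h3 := mul_le_mul_of_nonneg_left h2 hD0
      linarith
  have hmono := integral_mono_ae (H.integrable_xi_comp (μ := μ) hg T.nonneg)
    (((integrable_const (ξ b)).add ((((((hfarI.sub (hd2.const_mul (2 / 9))).sub
      (hSI.const_mul (108 * t ^ 2 / 18))).sub hGI).add (integrable_const 1)).add
      (hsqI.const_mul (1 / 2))).const_mul D)).add hXiI) hpt
  have hcalc : ∫ ω, (ξ b + D * ((((((farError μ h ψ g b ω).toReal
      - 2 / 9 * truncHeight g b ω ^ 2) - 108 * t ^ 2 / 18 * S.indicator (1 : Ω → ℝ) ω)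
      - G ω * Real.exp (-b)) + 1)
      + 1 / 2 * {ω | g ω < b}.indicator (fun ω => (b - g ω) ^ 2) ω)
      + {ω | g ω < b}.indicator (fun ω => bigXi ξ (g ω) b) ω) ∂μ
      = ξ b + D * (((((∫ ω, (farError μ h ψ g b ω).toReal ∂μ
        - 2 / 9 * ∫ ω, truncHeight g b ω ^ 2 ∂μ) - 108 * t ^ 2 / 18 * μ.real S)
        - (∫ ω, G ω ∂μ) * Real.exp (-b)) + 1)
        + 1 / 2 * ∫ ω, {ω | g ω < b}.indicator (fun ω => (b - g ω) ^ 2) ω ∂μ)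
        + ∫ ω, {ω | g ω < b}.indicator (fun ω => bigXi ξ (g ω) b) ω ∂μ := by
    have i1 := hfarI.sub (hd2.const_mul (2 / 9))
    have i2 := i1.sub (hSI.const_mul (108 * t ^ 2 / 18))
    have i3 := i2.sub hGI
    have i4 := i3.add (integrable_const (1 : ℝ))
    have i5 := i4.add (hsqI.const_mul (1 / 2))
    have i6 := (integrable_const (μ := μ) (ξ b)).add (i5.const_mul D)
    refine (integral_add' i6 hXiI).trans ?_
    congr 1
    refine (integral_add' (integrable_const (ξ b)) (i5.const_mul D)).trans ?_
    congr 1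
    · simp
    refine (integral_const_mul _ _).trans ?_
    congr 1
    refine (integral_add' i4 (hsqI.const_mul (1 / 2))).trans ?_
    congr 1
    · refine (integral_add' i3 (integrable_const (1 : ℝ))).trans ?_
      congr 1
      · refine (integral_sub' i2 hGI).trans ?_
        congr 1
        · refine (integral_sub' i1 (hSI.const_mul (108 * t ^ 2 / 18))).trans ?_
          congr 1
          · refine (integral_sub' hfarI (hd2.const_mul (2 / 9))).trans ?_
            rw [integral_const_mul]
          · rw [integral_const_mul, integral_indicator_one hSm]
        · exact integral_mul_const _ _
      · simp
    · exact integral_const_mul _ _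
  have hmono' := hmono.trans (le_of_eq hcalc)
  refine H.integral_le_of_linearized hb0 hM ?_
  have e1 : M - b + 1 ≤ (∫ ω, G ω ∂μ) * Real.exp (-b) := by
    rw [← hexpM, ← Real.exp_add]
    exact Real.add_one_le_exp (M - b)
  have e2 : 108 * t ^ 2 / 18 * (1 / 4) ≤ 108 * t ^ 2 / 18 * μ.real S :=
    mul_le_mul_of_nonneg_left hS1 (by positivity)
  have e3 : ((((∫ ω, (farError μ h ψ g b ω).toReal ∂μ
        - 2 / 9 * ∫ ω, truncHeight g b ω ^ 2 ∂μ) - 108 * t ^ 2 / 18 * μ.real S)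
        - (∫ ω, G ω ∂μ) * Real.exp (-b)) + 1)
        + 1 / 2 * ∫ ω, {ω | g ω < b}.indicator (fun ω => (b - g ω) ^ 2) ω ∂μ
        ≤ -(M - b) - t ^ 2 := by linarith
  have e4 := mul_le_mul_of_nonneg_left e3 hD0
  linarith

/-- The one-dimensional inequality: the point of linearization depends on whether the median of `g`
is below or above `M + 4 / K`, where `M = log ∫ G`. -/
theorem Transport.integral_xi_le [IsProbabilityMeasure μ] (T : Transport μ h ψ K L G g)
    (I : Isoperimetry μ h ψ w γ) (H : ThetaXi θ ξ) (hH : ConditionH ξ w)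
    (hK : 1000000 * (1 + 2 / γ) ^ 2 ≤ K) (hL : Real.log (∫ ω, G ω ∂μ) + 5 ≤ L) :
    ∫ ω, ξ (g ω) ∂μ ≤ ξ (Real.log (∫ ω, G ω ∂μ)) := by
  rcases lt_or_ge (μ.real {ω | g ω ≤ Real.log (∫ ω, G ω ∂μ) + 4 / K}) (1 / 2) with hm | hm
  · refine T.integral_xi_le_of_median_large I H hH ?_ hL hm
    have hγ := I.gamma_pos
    have h0 : 0 < 2 / γ := by positivity
    have h1 : 4 / γ = 2 * (2 / γ) := by ring
    nlinarith
  · exact T.integral_xi_le_of_median_small I H hH hK hL hm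

end

/-! ### Sections of a set, and the induction on the dimension -/

section

variable {Ω : Type*} {h : Ω → Ω → ℝ} {ψ : ℝ → ℝ} {N : ℕ}

lemma penaltyHull_nonempty (P : Penalty h ψ) {A : Set (Fin N → Ω)} (hA : A.Nonempty)
    (x : Fin N → Ω) : (penaltyHull h A x).Nonempty := by
  obtain ⟨y, hy⟩ := hA
  exact ⟨fun i => h (x i) (y i), subset_convexHull ℝ _ ⟨fun i => P.nonneg _ _, y, hy, fun _ => le_rfl⟩⟩

lemma penaltyDist_bddBelow (P : Penalty h ψ) (A : Set (Fin N → Ω)) (x : Fin N → Ω) :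
    BddBelow ((fun s : Fin N → ℝ => ∑ i, ψ (s i)) '' penaltyHull h A x) :=
  ⟨0, by rintro _ ⟨s, -, rfl⟩; exact Finset.sum_nonneg fun i _ => P.psi_nonneg _⟩

lemma penaltyDist_nonneg (P : Penalty h ψ) (A : Set (Fin N → Ω)) (x : Fin N → Ω) :
    0 ≤ penaltyDist h ψ A x :=
  Real.sInf_nonneg (by rintro _ ⟨s, -, rfl⟩; exact Finset.sum_nonneg fun i _ => P.psi_nonneg _)

/-- The section of `A` at the first coordinate `ω`. -/
def headSection (A : Set (Fin (N + 1) → Ω)) (ω : Ω) : Set (Fin N → Ω) :=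
  {x | (Fin.cons ω x : Fin (N + 1) → Ω) ∈ A}

lemma cons_mem_penaltyHull {A : Set (Fin (N + 1) → Ω)} (P : Penalty h ψ) {ω ω' : Ω}
    {x : Fin N → Ω} {s : Fin N → ℝ} (hs : s ∈ penaltyHull h (headSection A ω') x) :
    (Fin.cons (h ω ω') s : Fin (N + 1) → ℝ) ∈ penaltyHull h A (Fin.cons ω x) := by
  have hconv : Convex ℝ {s : Fin N → ℝ |
      (Fin.cons (h ω ω') s : Fin (N + 1) → ℝ) ∈ penaltyHull h A (Fin.cons ω x)} := by
    intro s hs s' hs' a b ha hb hab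
    have := (convex_convexHull ℝ (penaltySet h A (Fin.cons ω x))) hs hs' ha hb hab
    have e : (Fin.cons (h ω ω') (a • s + b • s') : Fin (N + 1) → ℝ)
        = a • (Fin.cons (h ω ω') s : Fin (N + 1) → ℝ) + b • (Fin.cons (h ω ω') s') := by
      ext i
      refine Fin.cases ?_ (fun j => ?_) i
      · simp [← add_mul, hab]
      · simp
    show (Fin.cons (h ω ω') (a • s + b • s') : Fin (N + 1) → ℝ) ∈
      penaltyHull h A (Fin.cons ω x)
    rw [e]
    exact this
  refine convexHull_min ?_ hconv hs
  rintro s ⟨hs0, y, hy, hys⟩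
  refine subset_convexHull ℝ _ ⟨fun i => ?_, Fin.cons ω' y, hy, fun i => ?_⟩
  · refine Fin.cases ?_ (fun j => ?_) i
    · simpa using P.nonneg _ _
    · simpa using hs0 j
  · refine Fin.cases ?_ (fun j => ?_) i
    · simp
    · simpa using hys j

/-- Changing the first coordinate costs `h ω ω'`. -/
lemma penaltyDist_cons_le_jump {A : Set (Fin (N + 1) → Ω)} (P : Penalty h ψ) {ω ω' : Ω}
    (hA : (headSection A ω').Nonempty) (x : Fin N → Ω) :
    penaltyDist h ψ A (Fin.cons ω x) ≤ ψ (h ω ω') + penaltyDist h ψ (headSection A ω') x := by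
  rw [← sub_le_iff_le_add']
  refine le_csInf ((penaltyHull_nonempty P hA x).image _) ?_
  rintro _ ⟨s, hs, rfl⟩
  have : penaltyDist h ψ A (Fin.cons ω x)
      ≤ ∑ i, ψ ((Fin.cons (h ω ω') s : Fin (N + 1) → ℝ) i) :=
    csInf_le (penaltyDist_bddBelow P A (Fin.cons ω x))
      (mem_image_of_mem _ (cons_mem_penaltyHull (ω := ω) P hs))
  simp only [Fin.sum_univ_succ, Fin.cons_zero, Fin.cons_succ] at this
  rw [sub_le_iff_le_add']
  exact this

/-- Thanks to the convex hull, the two sections at `ω` and `ω'` can be mixed, and the cost is then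
that of a fraction of `h ω ω'`. -/
lemma penaltyDist_cons_le {A : Set (Fin (N + 1) → Ω)} (P : Penalty h ψ) {ω ω' : Ω} {t : ℝ}
    (ht0 : 0 ≤ t) (ht1 : t ≤ 1) (hA : (headSection A ω).Nonempty)
    (hA' : (headSection A ω').Nonempty) (x : Fin N → Ω) :
    penaltyDist h ψ A (Fin.cons ω x) ≤ ψ (t * h ω ω')
      + (1 - t) * penaltyDist h ψ (headSection A ω) x
      + t * penaltyDist h ψ (headSection A ω') x := by
  have hmix : ∀ s ∈ penaltyHull h (headSection A ω) x, ∀ s' ∈ penaltyHull h (headSection A ω') x,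
      penaltyDist h ψ A (Fin.cons ω x)
        ≤ ψ (t * h ω ω') + (1 - t) * ∑ i, ψ (s i) + t * ∑ i, ψ (s' i) := by
    intro s hs s' hs'
    have hm := (convex_convexHull ℝ (penaltySet h A (Fin.cons ω x)))
      (cons_mem_penaltyHull (ω := ω) P hs) (cons_mem_penaltyHull (ω := ω) P hs')
      (sub_nonneg.2 ht1) ht0 (by ring)
    refine (csInf_le (penaltyDist_bddBelow P A (Fin.cons ω x)) (mem_image_of_mem _ hm)).trans ?_
    simp only [Fin.sum_univ_succ, Pi.add_apply, Pi.smul_apply, Fin.cons_zero, Fin.cons_succ,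
      P.self, smul_eq_mul, mul_zero, zero_add]
    rw [add_assoc, Finset.mul_sum, Finset.mul_sum, ← Finset.sum_add_distrib]
    refine add_le_add_right (Finset.sum_le_sum fun i _ => ?_) _
    have := P.convex.2 (mem_univ (s i)) (mem_univ (s' i)) (sub_nonneg.2 ht1) ht0 (by ring)
    simpa using this
  refine le_of_forall_pos_le_add fun ε hε => ?_
  obtain ⟨_, ⟨s, hs, rfl⟩, hlt⟩ := exists_lt_of_csInf_lt
    ((penaltyHull_nonempty P hA x).image fun s : Fin N → ℝ => ∑ i, ψ (s i))
    (show penaltyDist h ψ (headSection A ω) x < penaltyDist h ψ (headSection A ω) x + ε by linarith)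
  obtain ⟨_, ⟨s', hs', rfl⟩, hlt'⟩ := exists_lt_of_csInf_lt
    ((penaltyHull_nonempty P hA' x).image fun s : Fin N → ℝ => ∑ i, ψ (s i))
    (show penaltyDist h ψ (headSection A ω') x < penaltyDist h ψ (headSection A ω') x + ε by
      linarith)
  have h1 := hmix s hs s' hs'
  have h2 := mul_le_mul_of_nonneg_left hlt.le (sub_nonneg.2 ht1)
  have h3 := mul_le_mul_of_nonneg_left hlt'.le ht0
  linarith

end

section

variable {Ω : Type*} [MeasurableSpace Ω] {μ : Measure Ω} {h : Ω → Ω → ℝ} {ψ : ℝ → ℝ} {N : ℕ}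
  {K : ℝ}

/-- The exponential moment of `f_{h,ψ}(A, ·) / K` over the last `N` coordinates, as a function of
the first one. -/
noncomputable def headMoment (μ : Measure Ω) (h : Ω → Ω → ℝ) (ψ : ℝ → ℝ) (K : ℝ)
    (A : Set (Fin (N + 1) → Ω)) (ω : Ω) : ENNReal :=
  ∫⁻ x, ENNReal.ofReal (Real.exp (1 / K * penaltyDist h ψ A (Fin.cons ω x)))
    ∂(Measure.pi fun _ : Fin N => μ)

lemma headMoment_le_jump {A : Set (Fin (N + 1) → Ω)} (P : Penalty h ψ) (hK : 0 < K) {ω ω' : Ω}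
    (hA : (headSection A ω').Nonempty) {c : ℝ}
    (hc : ∫⁻ x, ENNReal.ofReal (Real.exp (1 / K * penaltyDist h ψ (headSection A ω') x))
      ∂(Measure.pi fun _ : Fin N => μ) ≤ ENNReal.ofReal (Real.exp c)) :
    headMoment μ h ψ K A ω ≤ ENNReal.ofReal (Real.exp (ψ (h ω ω') / K + c)) := by
  calc headMoment μ h ψ K A ω
      ≤ ∫⁻ x, ENNReal.ofReal (Real.exp (ψ (h ω ω') / K)) *
        ENNReal.ofReal (Real.exp (1 / K * penaltyDist h ψ (headSection A ω') x))
          ∂(Measure.pi fun _ : Fin N => μ) := by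
        refine lintegral_mono fun x => ?_
        rw [← ENNReal.ofReal_mul (Real.exp_pos _).le, ← Real.exp_add]
        refine ENNReal.ofReal_le_ofReal (Real.exp_le_exp.2 ?_)
        have := mul_le_mul_of_nonneg_left (penaltyDist_cons_le_jump (ω := ω) P hA x)
          (one_div_pos.2 hK).le
        refine this.trans (le_of_eq ?_)
        ring
    _ ≤ ENNReal.ofReal (Real.exp (ψ (h ω ω') / K)) * ENNReal.ofReal (Real.exp c) := by
        rw [lintegral_const_mul' _ _ ENNReal.ofReal_ne_top]
        gcongr
    _ = ENNReal.ofReal (Real.exp (ψ (h ω ω') / K + c)) := by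
        rw [← ENNReal.ofReal_mul (Real.exp_pos _).le, ← Real.exp_add]

/-- Hölder's inequality turns the mixing of two sections into an interpolation between their
exponential moments. -/
lemma headMoment_le_interpolate {A : Set (Fin (N + 1) → Ω)} (P : Penalty h ψ) (hK : 0 < K)
    {ω ω' : Ω} (hA : (headSection A ω).Nonempty) (hA' : (headSection A ω').Nonempty)
    (hm : AEMeasurable (fun x => penaltyDist h ψ (headSection A ω) x)
      (Measure.pi fun _ : Fin N => μ))
    (hm' : AEMeasurable (fun x => penaltyDist h ψ (headSection A ω') x)
      (Measure.pi fun _ : Fin N => μ)) {c c' t : ℝ} (ht0 : 0 ≤ t) (ht1 : t ≤ 1)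
    (hc : ∫⁻ x, ENNReal.ofReal (Real.exp (1 / K * penaltyDist h ψ (headSection A ω) x))
      ∂(Measure.pi fun _ : Fin N => μ) ≤ ENNReal.ofReal (Real.exp c))
    (hc' : ∫⁻ x, ENNReal.ofReal (Real.exp (1 / K * penaltyDist h ψ (headSection A ω') x))
      ∂(Measure.pi fun _ : Fin N => μ) ≤ ENNReal.ofReal (Real.exp c')) :
    headMoment μ h ψ K A ω
      ≤ ENNReal.ofReal (Real.exp (ψ (t * h ω ω') / K + (1 - t) * c + t * c')) := by
  have hrpow : ∀ r y : ℝ, 0 ≤ r →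
      ENNReal.ofReal (Real.exp y) ^ r = ENNReal.ofReal (Real.exp (r * y)) := by
    intro r y hr
    rw [ENNReal.ofReal_rpow_of_pos (Real.exp_pos _), ← Real.exp_mul, mul_comm]
  have ht' : 0 ≤ 1 - t := sub_nonneg.2 ht1
  calc headMoment μ h ψ K A ω
      ≤ ∫⁻ x, ENNReal.ofReal (Real.exp (ψ (t * h ω ω') / K)) *
        (ENNReal.ofReal (Real.exp (1 / K * penaltyDist h ψ (headSection A ω) x)) ^ (1 - t) *
        ENNReal.ofReal (Real.exp (1 / K * penaltyDist h ψ (headSection A ω') x)) ^ t)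
          ∂(Measure.pi fun _ : Fin N => μ) := by
        refine lintegral_mono fun x => ?_
        rw [hrpow _ _ ht', hrpow _ _ ht0, ← ENNReal.ofReal_mul (Real.exp_pos _).le,
          ← Real.exp_add, ← ENNReal.ofReal_mul (Real.exp_pos _).le, ← Real.exp_add]
        refine ENNReal.ofReal_le_ofReal (Real.exp_le_exp.2 ?_)
        have := mul_le_mul_of_nonneg_left (penaltyDist_cons_le P ht0 ht1 hA hA' x)
          (one_div_pos.2 hK).le
        refine this.trans (le_of_eq ?_)
        ring
    _ ≤ ENNReal.ofReal (Real.exp (ψ (t * h ω ω') / K)) *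
        (ENNReal.ofReal (Real.exp c) ^ (1 - t) * ENNReal.ofReal (Real.exp c') ^ t) := by
        rw [lintegral_const_mul' _ _ ENNReal.ofReal_ne_top]
        gcongr
        refine (ENNReal.lintegral_mul_norm_pow_le
          (Real.measurable_exp.comp_aemeasurable (hm.const_mul _)).ennreal_ofReal
          (Real.measurable_exp.comp_aemeasurable (hm'.const_mul _)).ennreal_ofReal
          ht' ht0 (by ring)).trans ?_
        exact mul_le_mul' (ENNReal.rpow_le_rpow hc ht') (ENNReal.rpow_le_rpow hc' ht0)
    _ = _ := by
        rw [hrpow _ _ ht', hrpow _ _ ht0, ← ENNReal.ofReal_mul (Real.exp_pos _).le,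
          ← Real.exp_add, ← ENNReal.ofReal_mul (Real.exp_pos _).le, ← Real.exp_add, add_assoc]

lemma one_le_headMoment [IsProbabilityMeasure μ] (P : Penalty h ψ) (hK : 0 < K)
    (A : Set (Fin (N + 1) → Ω)) (ω : Ω) : 1 ≤ headMoment μ h ψ K A ω := by
  calc (1 : ENNReal) = ∫⁻ _, 1 ∂(Measure.pi fun _ : Fin N => μ) := by simp
    _ ≤ headMoment μ h ψ K A ω := by
      refine lintegral_mono fun x => ?_
      rw [← ENNReal.ofReal_one]
      refine ENNReal.ofReal_le_ofReal (Real.one_le_exp ?_)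
      exact mul_nonneg (one_div_pos.2 hK).le (penaltyDist_nonneg P _ _)

lemma measurePreserving_cons [IsProbabilityMeasure μ] :
    MeasurePreserving (fun z : Ω × (Fin N → Ω) => (Fin.cons z.1 z.2 : Fin (N + 1) → Ω))
      (μ.prod (Measure.pi fun _ : Fin N => μ)) (Measure.pi fun _ : Fin (N + 1) => μ) := by
  have := (measurePreserving_piFinSuccAbove (fun _ : Fin (N + 1) => μ) 0).symm
  convert this using 1
  ext z i
  simp [MeasurableEquiv.piFinSuccAbove, Fin.insertNthEquiv]

lemma lintegral_eq_lintegral_headMoment [IsProbabilityMeasure μ] (hm : PenaltyMeasurable μ h ψ)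
    {A : Set (Fin (N + 1) → Ω)} (hA : MeasurableSet A) :
    AEMeasurable (headMoment μ h ψ K A) μ ∧
    ∫⁻ x, ENNReal.ofReal (Real.exp (1 / K * penaltyDist h ψ A x))
      ∂(Measure.pi fun _ : Fin (N + 1) => μ) = ∫⁻ ω, headMoment μ h ψ K A ω ∂μ := by
  have hF : AEMeasurable (fun x => ENNReal.ofReal (Real.exp (1 / K * penaltyDist h ψ A x)))
      (Measure.pi fun _ : Fin (N + 1) => μ) :=
    (Real.measurable_exp.comp_aemeasurable ((hm (N + 1) A hA).const_mul _)).ennreal_ofReal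
  have hmp := measurePreserving_cons (μ := μ) (N := N)
  have hF' := hF.comp_quasiMeasurePreserving hmp.quasiMeasurePreserving
  refine ⟨hF'.lintegral_prod_right', ?_⟩
  rw [← hmp.map_eq, lintegral_map' (by rw [hmp.map_eq]; exact hF) hmp.measurable.aemeasurable]
  exact lintegral_prod _ hF'

lemma measurableSet_headSection {A : Set (Fin (N + 1) → Ω)} (hA : MeasurableSet A) (ω : Ω) :
    MeasurableSet (headSection A ω) := by
  have hm : Measurable fun x : Fin N → Ω => (Fin.cons ω x : Fin (N + 1) → Ω) := by
    refine measurable_pi_iff.2 fun i => ?_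
    refine Fin.cases ?_ (fun j => ?_) i
    · simp
    · simpa using measurable_pi_apply j
  exact hm hA

lemma measure_eq_integral_headSection [IsProbabilityMeasure μ] {A : Set (Fin (N + 1) → Ω)}
    (hA : MeasurableSet A) :
    Measurable (fun ω => (Measure.pi fun _ : Fin N => μ).real (headSection A ω)) ∧
    (Measure.pi fun _ : Fin (N + 1) => μ).real A
      = ∫ ω, (Measure.pi fun _ : Fin N => μ).real (headSection A ω) ∂μ := by
  have hmp := measurePreserving_cons (μ := μ) (N := N)
  have hA' := hmp.measurable hA
  have hmeas : Measurable fun ω => (Measure.pi fun _ : Fin N => μ) (headSection A ω) :=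
    measurable_measure_prodMk_left hA'
  refine ⟨hmeas.ennreal_toReal, ?_⟩
  simp only [Measure.real]
  rw [integral_toReal hmeas.aemeasurable (Eventually.of_forall fun ω => measure_lt_top _ _),
    ← hmp.measure_preimage hA.nullMeasurableSet, Measure.prod_apply hA']
  rfl

end

section

variable {Ω : Type*} [MeasurableSpace Ω] {μ : Measure Ω} {h : Ω → Ω → ℝ} {ψ w θ ξ : ℝ → ℝ}
  {γ K : ℝ} {N : ℕ}

lemma ThetaXi.measurable_truncation (H : ThetaXi θ ξ) (L : ℝ) :
    Measurable fun u : ℝ => if 0 < u then min (θ (min u 1)) L else L := by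
  refine Antitone.measurable fun u v huv => ?_
  by_cases hu : 0 < u
  · have hv := hu.trans_le huv
    simp only [hu, hv, if_true]
    refine min_le_min_right L (H.decreasing.antitoneOn ⟨lt_min hu one_pos, min_le_right _ _⟩
      ⟨lt_min hv one_pos, min_le_right _ _⟩ (min_le_min_right 1 huv))
  · simp only [hu, if_false]
    split_ifs
    · exact min_le_right _ _
    · exact le_rfl

/-- The induction step. The moments are truncated at `n` to keep all integrals finite. -/
lemma lintegral_headMoment_le [IsProbabilityMeasure μ] (I : Isoperimetry μ h ψ w γ)
    (H : ThetaXi θ ξ) (hH : ConditionH ξ w) (hK : 1000000 * (1 + 2 / γ) ^ 2 ≤ K)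
    (ih : ∀ A : Set (Fin N → Ω), MeasurableSet A → 0 < (Measure.pi fun _ : Fin N => μ).real A →
      ∫⁻ x, ENNReal.ofReal (Real.exp (1 / K * penaltyDist h ψ A x))
        ∂(Measure.pi fun _ : Fin N => μ)
        ≤ ENNReal.ofReal (Real.exp (θ ((Measure.pi fun _ : Fin N => μ).real A))))
    {A : Set (Fin (N + 1) → Ω)} (hA : MeasurableSet A)
    (hA0 : 0 < (Measure.pi fun _ : Fin (N + 1) => μ).real A) (n : ℕ) :
    ∫⁻ ω, min (headMoment μ h ψ K A ω) (n + 1 : ℕ) ∂μ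
      ≤ ENNReal.ofReal (Real.exp (θ ((Measure.pi fun _ : Fin (N + 1) => μ).real A))) := by
  have P := I.penalty
  have hγ := I.gamma_pos
  have hK0 : 0 < K := lt_of_lt_of_le (by positivity) hK
  set ν := Measure.pi fun _ : Fin N => μ with hν
  set G : Ω → ℝ := fun ω => (min (headMoment μ h ψ K A ω) (n + 1 : ℕ)).toReal with hG
  have htop : ∀ ω, min (headMoment μ h ψ K A ω) ((n + 1 : ℕ) : ENNReal) ≠ ⊤ := fun ω =>
    ne_top_of_le_ne_top (ENNReal.natCast_ne_top _) (min_le_right _ _)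
  have hGae : AEMeasurable G μ :=
    ((lintegral_eq_lintegral_headMoment I.measurable hA).1.min aemeasurable_const).ennreal_toReal
  have hG1 : ∀ ω, 1 ≤ G ω := fun ω => by
    rw [hG, ← ENNReal.ofReal_le_iff_le_toReal (htop ω), ENNReal.ofReal_one]
    exact le_min (one_le_headMoment P hK0 A ω) (by exact_mod_cast Nat.succ_pos n)
  have hGle : ∀ ω c, headMoment μ h ψ K A ω ≤ ENNReal.ofReal (Real.exp c) → G ω ≤ Real.exp c :=
    fun ω c hc => ENNReal.toReal_le_of_le_ofReal (Real.exp_pos c).le ((min_le_left _ _).trans hc)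
  set p : Ω → ℝ := fun ω => ν.real (headSection A ω) with hp
  obtain ⟨hpm, hpA⟩ := measure_eq_integral_headSection (μ := μ) hA
  set L := Real.log (∫ ω, G ω ∂μ) + 5 with hL
  have hGi : Integrable G μ := by
    refine Integrable.of_bound hGae.aestronglyMeasurable (n + 1 : ℕ) (Eventually.of_forall fun ω => ?_)
    rw [Real.norm_of_nonneg ENNReal.toReal_nonneg]
    exact ENNReal.toReal_le_of_le_ofReal (Nat.cast_nonneg _)
      (by rw [ENNReal.ofReal_natCast]; exact min_le_right _ _)
  have hGint : 1 ≤ ∫ ω, G ω ∂μ := by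
    have := integral_mono (μ := μ) (integrable_const 1) hGi hG1
    simpa using this
  have hM : 0 ≤ Real.log (∫ ω, G ω ∂μ) := Real.log_nonneg hGint
  have hp1 : ∀ ω, p ω ≤ 1 := fun ω => measureReal_le_one
  set g : Ω → ℝ := fun ω => if 0 < p ω then min (θ (min (p ω) 1)) L else L with hg
  have hgL : ∀ ω, g ω < L → 0 < p ω ∧ g ω = θ (p ω) := by
    intro ω hω
    by_cases h0 : 0 < p ω
    · simp only [hg, h0, if_true, min_eq_left (hp1 ω)] at hω ⊢
      refine ⟨trivial, min_eq_left ?_⟩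
      rcases min_lt_iff.1 hω with h1 | h1
      · exact h1.le
      · exact absurd h1 (lt_irrefl _)
    · simp [hg, h0] at hω
  have hne : ∀ ω, 0 < p ω → (headSection A ω).Nonempty := fun ω hω =>
    nonempty_of_measureReal_ne_zero hω.ne'
  have hih : ∀ ω, 0 < p ω → ∫⁻ x, ENNReal.ofReal (Real.exp (1 / K *
      penaltyDist h ψ (headSection A ω) x)) ∂ν ≤ ENNReal.ofReal (Real.exp (θ (p ω))) :=
    fun ω hω => ih _ (measurableSet_headSection hA ω) hω
  have T : Transport μ h ψ K L G g :=
    { aemeasurable := hGae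
      one_le := hG1
      bounded := ⟨(n + 1 : ℕ), fun ω => ENNReal.toReal_le_of_le_ofReal (Nat.cast_nonneg _)
        (by rw [ENNReal.ofReal_natCast]; exact min_le_right _ _)⟩
      measurable := (H.measurable_truncation L).comp hpm
      nonneg := fun ω => by
        by_cases h0 : 0 < p ω
        · simp only [hg, h0, if_true, min_eq_left (hp1 ω)]
          exact le_min (H.theta_maps ⟨h0, hp1 ω⟩) (by linarith)
        · simp only [hg, h0, if_false]; linarith
      le := fun ω => by
        simp only [hg]
        split_ifs
        · exact min_le_right _ _
        · exact le_rfl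
      jump := fun ω ω' hω' => by
        obtain ⟨h0, h1⟩ := hgL ω' hω'
        rw [h1]
        exact hGle ω _ (headMoment_le_jump P hK0 (hne ω' h0) (hih ω' h0))
      interpolate := fun ω ω' s hs0 hs1 hω hω' => by
        obtain ⟨h0, h1⟩ := hgL ω hω
        obtain ⟨h0', h1'⟩ := hgL ω' hω'
        rw [h1, h1']
        exact hGle ω _ (headMoment_le_interpolate P hK0 (hne ω h0) (hne ω' h0')
          (I.measurable N _ (measurableSet_headSection hA ω))
          (I.measurable N _ (measurableSet_headSection hA ω')) hs0 hs1 (hih ω h0) (hih ω' h0')) }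
  have hmain := T.integral_xi_le I H hH hK le_rfl
  have hpξ : ∀ ω, p ω ≤ ξ (g ω) := by
    intro ω
    by_cases h0 : 0 < p ω
    · have hmem : p ω ∈ Ioc (0 : ℝ) 1 := ⟨h0, hp1 ω⟩
      have h1 : g ω ≤ θ (p ω) := by
        simp only [hg, h0, if_true, min_eq_left (hp1 ω)]
        exact min_le_left _ _
      have := H.xi_strictAnti.antitoneOn (mem_Ici.2 (T.nonneg ω)) (H.theta_maps hmem) h1
      rwa [H.xi_theta hmem] at this
    · exact (not_lt.1 h0).trans (H.xi_maps (T.nonneg ω)).1.le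
  have hpi : Integrable p μ := by
    refine Integrable.of_bound hpm.aestronglyMeasurable 1 (Eventually.of_forall fun ω => ?_)
    rw [Real.norm_of_nonneg measureReal_nonneg]
    exact hp1 ω
  have hPξ : (Measure.pi fun _ : Fin (N + 1) => μ).real A ≤ ξ (Real.log (∫ ω, G ω ∂μ)) := by
    rw [hpA]
    exact (integral_mono hpi (H.integrable_xi_comp T.measurable T.nonneg) hpξ).trans hmain
  have hθ := H.decreasing.antitoneOn ⟨hA0, measureReal_le_one⟩ (H.xi_maps hM) hPξ
  rw [H.theta_xi hM] at hθ
  have hGexp : ∫ ω, G ω ∂μ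
      ≤ Real.exp (θ ((Measure.pi fun _ : Fin (N + 1) => μ).real A)) := by
    rw [← Real.log_le_iff_le_exp (by linarith)]
    exact hθ
  calc ∫⁻ ω, min (headMoment μ h ψ K A ω) (n + 1 : ℕ) ∂μ
      = ∫⁻ ω, ENNReal.ofReal (G ω) ∂μ :=
        lintegral_congr fun ω => (ENNReal.ofReal_toReal (htop ω)).symm
    _ = ENNReal.ofReal (∫ ω, G ω ∂μ) :=
        (ofReal_integral_eq_lintegral_ofReal hGi
          (Eventually.of_forall fun ω => ENNReal.toReal_nonneg)).symm
    _ ≤ _ := ENNReal.ofReal_le_ofReal hGexp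

/-- The inequality on `Ω ^ N`, by induction on `N`; the truncation of the moments is removed by
monotone convergence. -/
theorem lintegral_exp_penaltyDist_le [IsProbabilityMeasure μ] (I : Isoperimetry μ h ψ w γ)
    (H : ThetaXi θ ξ) (hH : ConditionH ξ w) (hK : 1000000 * (1 + 2 / γ) ^ 2 ≤ K) (N : ℕ) :
    ∀ A : Set (Fin N → Ω), MeasurableSet A → 0 < (Measure.pi fun _ : Fin N => μ).real A →
      ∫⁻ x, ENNReal.ofReal (Real.exp (1 / K * penaltyDist h ψ A x))
        ∂(Measure.pi fun _ : Fin N => μ)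
        ≤ ENNReal.ofReal (Real.exp (θ ((Measure.pi fun _ : Fin N => μ).real A))) := by
  induction N with
  | zero =>
    intro A hA hA0
    have hne : A.Nonempty := nonempty_of_measureReal_ne_zero hA0.ne'
    have hAu : A = univ := Subsingleton.eq_univ_of_nonempty hne
    have hdist : ∀ x : Fin 0 → Ω, penaltyDist h ψ A x = 0 := by
      intro x
      have himg : (fun s : Fin 0 → ℝ => ∑ i, ψ (s i)) '' penaltyHull h A x = {0} := by
        have : (fun s : Fin 0 → ℝ => ∑ i, ψ (s i)) = fun _ => 0 := by ext s; simp
        rw [this, (penaltyHull_nonempty I.penalty hne x).image_const]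
      rw [penaltyDist, himg, csInf_singleton]
    rw [hAu] at hdist ⊢
    simp [hdist, H.map_one]
  | succ N ih =>
    intro A hA hA0
    obtain ⟨hae, heq⟩ := lintegral_eq_lintegral_headMoment (K := K) I.measurable hA
    rw [heq]
    have hsup : ∀ ω, headMoment μ h ψ K A ω
        = ⨆ n : ℕ, min (headMoment μ h ψ K A ω) ((n + 1 : ℕ) : ENNReal) := by
      intro ω
      have htop : ⨆ n : ℕ, ((n + 1 : ℕ) : ENNReal) = ⊤ := by
        rw [eq_top_iff, ← ENNReal.iSup_natCast]
        exact iSup_mono fun n => by exact_mod_cast Nat.le_succ n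
      rw [← inf_iSup_eq, htop, inf_top_eq]
    have hmono : ∀ ω, Monotone fun n : ℕ =>
        min (headMoment μ h ψ K A ω) ((n + 1 : ℕ) : ENNReal) := fun ω m n hmn =>
      min_le_min_left _ (Nat.cast_le.2 (Nat.succ_le_succ hmn))
    rw [lintegral_congr hsup, lintegral_iSup' (fun n => hae.min aemeasurable_const)
      (Eventually.of_forall hmono)]
    exact iSup_le fun n => lintegral_headMoment_le I H hH hK ih hA hA0 n

end

theorem theorem4p4p1 (γ : ℝ) (hγ : 0 < γ) :
    ∃ K : ℝ, 0 < K ∧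
      ∀ (Ω : Type*) [MeasurableSpace Ω] (μ : Measure Ω) [IsProbabilityMeasure μ]
        (h : Ω → Ω → ℝ) (ψ θ ξ w : ℝ → ℝ),
        -- the penalty function
        (∀ x y, 0 ≤ h x y) → (∀ x, h x x = 0) →
        -- the convex function `ψ`
        ConvexOn ℝ univ ψ → ψ 0 = 0 →
        (∀ x, x ≤ 1 → ψ x ≤ x ^ 2) → (∀ x, 1 ≤ x → x ≤ ψ x) →
        -- measurability convention
        PenaltyMeasurable μ h ψ →
        -- the functions `θ`, `ξ` and the number `γ`
        ThetaXi θ ξ →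
        (∀ b, 0 ≤ b → γ * |derivOnNonneg ξ b| ≤ |derivOnNonneg ξ (b + 1)|) →
        γ ≤ |derivWithin θ (Ioc 0 1) 1| → γ ≤ w (1 / 2) →
        -- the function `w`
        (∀ u ∈ Ioc (0 : ℝ) 1, 0 ≤ w u) → AntitoneOn w (Ioc 0 1) →
        (∀ u ∈ Ioc (0 : ℝ) 1, w u ≤ θ u) →
        ∫⁻ u in Ioc (0 : ℝ) 1, ENNReal.ofReal (w u ^ 2) ≤ 1 →
        ConditionH ξ w →
        -- the two one-dimensional hypotheses
        (∀ B : Set Ω, MeasurableSet B → 0 < μ.real B → μ.real B ≤ 1 / 2 →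
          ∫⁻ x, ENNReal.ofReal (Real.exp (ψ (penaltyToSet h x B))) ∂μ
            ≤ ENNReal.ofReal (Real.exp (w (μ.real B)))) →
        (∀ B : Set Ω, MeasurableSet B → 1 / 2 ≤ μ.real B → ∀ t : ℝ, 1 ≤ t →
          μ {x | t ≤ ψ (penaltyToSet h x B)}
            ≤ ENNReal.ofReal (Real.exp (-t) * (1 - μ.real B))) →
        -- the conclusion
        ∀ (N : ℕ) (A : Set (Fin N → Ω)), MeasurableSet A →
          0 < (Measure.pi fun _ : Fin N => μ).real A →
          ∫⁻ x, ENNReal.ofReal (Real.exp (1 / K * penaltyDist h ψ A x))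
              ∂(Measure.pi fun _ : Fin N => μ)
            ≤ ENNReal.ofReal (Real.exp (θ ((Measure.pi fun _ : Fin N => μ).real A))) := by
  refine ⟨1000000 * (1 + 2 / γ) ^ 2, by positivity, ?_⟩
  intro Ω _ μ _ h ψ θ ξ w hh hself hconv hψ0 hsq hid hmeas H _ _ hhalf hw0 hwanti _ hw2 hH hsmall
    hlarge N A hA hA0
  exact lintegral_exp_penaltyDist_le ⟨⟨hh, hself, hconv, hψ0, hsq, hid⟩, hmeas, hγ, hhalf, hw0,
    hwanti, hw2, hsmall, hlarge⟩ H hH le_rfl N A hA hA0
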